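/- **Model.** Base stations (BSs) form a homogeneous Poisson point process $\Phi$ of density $\lambda>0$ in the plane; the typical user sits at the origin; user density is $\rho>0$. The active BSs form a homogeneous Poisson process $\tilde\Phi\subseteq\Phi$ of density $\tilde\lambda=\lambda\bigl[1-(1+\frac{\rho}{q\lambda})^{-q}\bigr]$, where $q>0$ is a constant (the coupling of $\tilde\Phi$ with $\Phi$ is otherwise arbitrary). Let $L>0$ be the antenna height difference; a BS at 2D distance $r$ has 3D distance $w=\sqrt{r^2+L^2}$. There are cut-off distances $L<d_1<\dots<d_{N-1}$ ($N\ge1$) that split $[L,\infty)$ into the pieces $[L,d_1],(d_1,d_2],\dots,(d_{N-1},\infty)$. Given the positions and the activity of the BSs, the links to the typical user are independent; a link with $w$ in the $n$-th piece is line-of-sight (LoS) with probability $\mathrm{Pr}^{\rm L}(w)=\mathrm{Pr}^{\rm L}_n(w)\in[0,1]$ and then has path loss $\zeta^{\rm L}(w)=\zeta^{\rm L}_n(w)=A^{\rm L}_nw^{-\alpha^{\rm L}_n}$, and is non-line-of-sight (NLoS) otherwise, with path loss $\zeta^{\rm NL}(w)=\zeta^{\rm NL}_n(w)=A^{\rm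 NL}_nw^{-\alpha^{\rm NL}_n}$; all $A$'s and $\alpha$'s are positive and each $\mathrm{Pr}^{\rm L}_n$ is decreasing on its piece. Links have i.i.d. fading gains, exponential with mean one, independent of everything else. Assume that $\mathrm{Pr}^{\rm L}_1(w)>0$ for some $w>L$ in the first piece, and that no link is stronger than a first-piece LoS link at distance $L$: $\zeta^{\rm L}(w)\le\zeta^{\rm L}_1(L)$ and $\zeta^{\rm NL}(w)\le\zeta^{\rm L}_1(L)$ for all $w\ge L$. The typical user is served by the BS $b_o\in\Phi$ with the largest path-loss value $\zeta$ (maximum average received power). With transmission power $P>0$, noise power $P_{\rm N}\ge0$, fading gain $h$ of the serving link, and fading gain $g_i$ and path loss $\beta_i$ of the link from BS $b_i$, let $I_{\rm agg}=\sum_{b_i\in\tilde\Phi\setminus b_o}P\beta_ig_i$, $\mathrm{SINR}=P\zeta h/(I_{\rm agg}+P_{\rm N})$ with $\zeta$ the path loss of the serving link, $\mathscr L_{I_{\rm agg}}(s)=\mathbb E[e^{-sI_{\rm agg}}]$, and $p^{\rm cov}(\lambda,\rho,\gamma)=\Pr[\mathrm{SINR}>\gamma]$ for a threshold $\gamma>0$.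 **Theorem.** Put $s=\frac{\gamma}{P\zeta^{\rm L}_1(L)}$. Then $\lim_{\lambda\to\infty}\tilde\lambda=\rho$, all the following limits exist, and $$\lim_{\lambda\to\infty}p^{\rm cov}(\lambda,\rho,\gamma)=\lim_{\lambda\to\infty}\Pr\Bigl[\frac{P\zeta^{\rm L}_1(L)h}{I_{\rm agg}+P_{\rm N}}>\gamma\Bigr]=\exp\Bigl(-\frac{P_{\rm N}\gamma}{P\zeta^{\rm L}_1(L)}\Bigr)\lim_{\lambda\to\infty}\mathscr L_{I_{\rm agg}}(s),$$ where $$\lim_{\lambda\to\infty}\mathscr L_{I_{\rm agg}}(s)=\exp\Bigl(-2\pi\rho\int_0^\infty\frac{\mathrm{Pr}^{\rm L}(\sqrt{u^2+L^2})\,u}{1+\bigl(sP\zeta^{\rm L}(\sqrt{u^2+L^2})\bigr)^{-1}}du\Bigr)\exp\Bigl(-2\pi\rho\int_0^\infty\frac{\bigl[1-\mathrm{Pr}^{\rm L}(\sqrt{u^2+L^2})\bigr]u}{1+\bigl(sP\zeta^{\rm NL}(\sqrt{u^2+L^2})\bigr)^{-1}}du\Bigr),$$ with $e^{-\infty}=0$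 if an integral diverges (then $I_{\rm agg}=\infty$ almost surely and $\mathrm{SINR}=0$). -/

import Mathlib

open MeasureTheory ProbabilityTheory Filter Topology Set
open scoped ENNReal NNReal

noncomputable section

namespace UDN

/-- The plane in which base stations (BSs) are deployed; the typical user (UE) is at the origin. -/
abbrev Plane : Type := EuclideanSpace ℝ (Fin 2)

/-- The multi-piece LoS/NLoS path-loss model with `k + 1` pieces separated by the `k` cut-off
distances `d 0 < ⋯ < d (k-1)`. Pieces are numbered from `0`: the first piece is piece `0`.
`L` is the BS-to-UE antenna height difference. -/
structure PathLoss (k : ℕ) where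
  /-- antenna height difference -/
  L : ℝ
  /-- cut-off distances -/
  d : Fin k → ℝ
  /-- LoS path losses at reference distance `1` -/
  AL : Fin (k + 1) → ℝ
  /-- NLoS path losses at reference distance `1` -/
  ANL : Fin (k + 1) → ℝ
  /-- LoS path-loss exponents -/
  aL : Fin (k + 1) → ℝ
  /-- NLoS path-loss exponents -/
  aNL : Fin (k + 1) → ℝ
  /-- LoS probability functions of the pieces -/
  prL : Fin (k + 1) → ℝ → ℝ

namespace PathLoss

variable {k : ℕ} (M : PathLoss k)

/-- The piece to which the 3D distance `w` belongs: the number of cut-off distances that are `< w`,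
so piece `0` is `w ≤ d 0`, piece `n` is `d (n-1) < w ≤ d n`, and piece `k` is `d (k-1) < w`. -/
def piece (w : ℝ) : Fin (k + 1) :=
  ⟨(Finset.univ.filter fun n : Fin k => M.d n < w).card,
    Nat.lt_succ_of_le ((Finset.card_le_univ _).trans (Fintype.card_fin k).le)⟩

/-- The LoS path-loss function of the `n`-th piece. -/
def zetaPieceL (n : Fin (k + 1)) (w : ℝ) : ℝ := M.AL n * w ^ (-(M.aL n))

/-- The NLoS path-loss function of the `n`-th piece. -/
def zetaPieceNL (n : Fin (k + 1)) (w : ℝ) : ℝ := M.ANL n * w ^ (-(M.aNL n))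

/-- The stacked (piecewise) LoS path-loss function. -/
def zetaL (w : ℝ) : ℝ := M.zetaPieceL (M.piece w) w

/-- The stacked (piecewise) NLoS path-loss function. -/
def zetaNL (w : ℝ) : ℝ := M.zetaPieceNL (M.piece w) w

/-- The stacked (piecewise) LoS probability function. -/
def PrL (w : ℝ) : ℝ := M.prL (M.piece w) w

/-- The 3D distance of a link with 2D distance `r`. -/
def dist3 (r : ℝ) : ℝ := Real.sqrt (r ^ 2 + M.L ^ 2)

/-- The standing assumptions on the parameters of the path-loss model. -/
structure Valid : Prop where
  L_pos : 0 < M.L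
  d_strictMono : StrictMono M.d
  /-- the first piece `[L, d 0]` is a non-degenerate interval -/
  L_lt_d : ∀ n, M.L < M.d n
  AL_pos : ∀ n, 0 < M.AL n
  ANL_pos : ∀ n, 0 < M.ANL n
  aL_pos : ∀ n, 0 < M.aL n
  aNL_pos : ∀ n, 0 < M.aNL n
  /-- each LoS probability function is a probability on its piece ... -/
  prL_mem : ∀ n w, M.L ≤ w → M.piece w = n → M.prL n w ∈ Icc (0 : ℝ) 1
  /-- ... and monotonically decreasing there -/
  prL_anti : ∀ n, AntitoneOn (M.prL n) {w | M.L ≤ w ∧ M.piece w = n}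

end PathLoss

/-- `N B ω` is the number of points in `B` of a random point configuration. The configuration is a
homogeneous Poisson point process in the plane with density `lam`: the number of points in a
bounded Borel set is Poisson distributed with mean `lam` times the area, and the numbers of points
in finitely many pairwise disjoint bounded Borel sets are independent. -/
structure IsHPPP {Ω : Type*} [MeasurableSpace Ω] (N : Set Plane → Ω → ℕ∞) (lam : ℝ)
    (μ : Measure Ω) : Prop where
  law : ∀ B : Set Plane, MeasurableSet B → Bornology.IsBounded B →
    HasLaw (N B) ((poissonMeasure (lam * volume.real B).toNNReal).map (fun n : ℕ => (n : ℕ∞))) μ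
  indep : ∀ (m : ℕ) (B : Fin m → Set Plane), (∀ j, MeasurableSet (B j)) →
    (∀ j, Bornology.IsBounded (B j)) → Pairwise (fun i j => Disjoint (B i) (B j)) →
    iIndepFun (fun j => N (B j)) μ

/-- The random objects of the downlink network: for the `i`-th BS, its position `X i`, whether it is
active, the variable `U i` which decides whether its link to the typical UE is LoS, and the
multi-path fading gain `h i` of that link. -/
structure Network (Ω : Type*) where
  X : ℕ → Ω → Plane
  active : ℕ → Ω → Prop
  U : ℕ → Ω → ℝ
  h : ℕ → Ω → ℝ

/-- The density of active BSs for BS density `lam` and UE density `rho`. -/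
def activeDensity (q rho lam : ℝ) : ℝ := lam * (1 - 1 / (1 + rho / (q * lam)) ^ q)

/-- `exp (-x)` for `x ∈ [0, ∞]`, with `exp (-∞) = 0`. -/
def expNeg (x : ℝ≥0∞) : ℝ := if x = ∞ then 0 else Real.exp (-x.toReal)

namespace Network

variable {Ω : Type*} (S : Network Ω)

/-- The number of BSs in `B`. -/
def count (B : Set Plane) (ω : Ω) : ℕ∞ := {i : ℕ | S.X i ω ∈ B}.encard

/-- The number of active BSs in `B`. -/
def activeCount (B : Set Plane) (ω : Ω) : ℕ∞ := {i : ℕ | S.active i ω ∧ S.X i ω ∈ B}.encard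

/-- The probabilistic model: the BSs form a homogeneous Poisson process of density `lam`, the active
BSs form a homogeneous Poisson process of density `activeDensity q rho lam`, and the marks of the
links to the typical UE are i.i.d. and independent of the BS deployment and of the BS activity:
`U i` is uniform on `[0, 1]` and `h i` is exponential with mean one, independent of `U i`.
How activity depends on the deployment is not restricted. -/
structure Valid [MeasurableSpace Ω] (μ : Measure Ω) (q rho lam : ℝ) : Prop where
  measurable_X : ∀ i, Measurable (S.X i)
  measurable_active : ∀ i, Measurable (S.active i)
  measurable_U : ∀ i, Measurable (S.U i)
  measurable_h : ∀ i, Measurable (S.h i)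
  hppp : IsHPPP S.count lam μ
  hppp_active : IsHPPP S.activeCount (activeDensity q rho lam) μ
  law_mark : ∀ i, HasLaw (fun ω => (S.U i ω, S.h i ω))
    ((volume.restrict (Icc (0 : ℝ) 1)).prod (expMeasure 1)) μ
  indep_mark : iIndepFun (fun i ω => (S.U i ω, S.h i ω)) μ
  indep_deployment : IndepFun (fun ω i => (S.X i ω, S.active i ω))
    (fun ω i => (S.U i ω, S.h i ω)) μ

variable {k : ℕ} (M : PathLoss k)

/-- The 3D distance between the `i`-th BS and the typical UE. -/
def w (i : ℕ) (ω : Ω) : ℝ := M.dist3 ‖S.X i ω‖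

open Classical in
/-- The path loss of the link from the `i`-th BS to the typical UE: given its 3D distance, the link
is LoS with the LoS probability at that distance, and NLoS otherwise. -/
def pathLoss (i : ℕ) (ω : Ω) : ℝ :=
  if S.U i ω < M.PrL (S.w M i ω) then M.zetaL (S.w M i ω) else M.zetaNL (S.w M i ω)

/-- The BS serving the typical UE: the one with the maximum average received power, i.e. with the
largest path-loss value (ties, which have probability zero, are broken by the smallest index). -/
def serving (ω : Ω) : ℕ := sInf {i : ℕ | ∀ j, S.pathLoss M j ω ≤ S.pathLoss M i ω}

open Classical in
/-- The aggregate interference at the typical UE: the sum over all active BSs other than the serving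
BS of the received powers, for BS transmission power `P`. -/
def interference (P : ℝ) (ω : Ω) : ℝ≥0∞ :=
  ∑' i : ℕ, if S.active i ω ∧ i ≠ S.serving M ω then
    ENNReal.ofReal (P * S.pathLoss M i ω * S.h i ω) else 0

/-- The SINR of the typical UE when the path loss of its serving link is `z`. -/
def sinrWith (P PN z : ℝ) (ω : Ω) : ℝ≥0∞ :=
  ENNReal.ofReal (P * z * S.h (S.serving M ω) ω) / (S.interference M P ω + ENNReal.ofReal PN)

/-- The SINR of the typical UE. -/
def sinr (P PN : ℝ) (ω : Ω) : ℝ≥0∞ :=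
  S.sinrWith M P PN (S.pathLoss M (S.serving M ω) ω) ω

/-- The coverage probability at SINR threshold `g`. -/
def pcov [MeasurableSpace Ω] (μ : Measure Ω) (P PN g : ℝ) : ℝ :=
  μ.real {ω | ENNReal.ofReal g < S.sinr M P PN ω}

/-- The Laplace transform `E [exp (-s I)]` of the aggregate interference. -/
def laplace [MeasurableSpace Ω] (μ : Measure Ω) (P s : ℝ) : ℝ :=
  ∫ ω, expNeg (ENNReal.ofReal s * S.interference M P ω) ∂μ

end Network

namespace PathLoss

variable {k : ℕ} (M : PathLoss k)

/-- The integral over the LoS interferers, with values in `[0, ∞]`. -/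
def integralL (P s : ℝ) : ℝ≥0∞ :=
  ∫⁻ u in Ioi (0 : ℝ), ENNReal.ofReal
    (M.PrL (M.dist3 u) * u / (1 + (s * P * M.zetaL (M.dist3 u))⁻¹))

/-- The integral over the NLoS interferers, with values in `[0, ∞]`. -/
def integralNL (P s : ℝ) : ℝ≥0∞ :=
  ∫⁻ u in Ioi (0 : ℝ), ENNReal.ofReal
    ((1 - M.PrL (M.dist3 u)) * u / (1 + (s * P * M.zetaNL (M.dist3 u))⁻¹))

/-- The limiting Laplace transform of the aggregate interference. -/
def limitLaplace (P rho s : ℝ) : ℝ :=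
  expNeg (ENNReal.ofReal (2 * Real.pi * rho) * M.integralL P s) *
    expNeg (ENNReal.ofReal (2 * Real.pi * rho) * M.integralNL P s)

end PathLoss

end UDN

end

/-!
Weighting the point counts of a Poisson process gives its Laplace functional; as it is
multiplicative, the independent link marks can be integrated out point by point, so that a marked
Poisson process behaves like a Poisson process on the product of the plane with the mark space.
This computes exactly the Laplace transform of the total power received from *all* active base
stations, at a density `λ̃ → ρ`, and the probability `exp (-λ Λ)` that no link is stronger than
`z`, where `Λ` is the mean measure of the stronger links at unit density. The latter tends to `0`
for each `z < ζ`, with `ζ` the peak path loss, since then `Λ > 0`. Hence the serving link is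
eventually as strong as any prescribed `z < ζ`. As `z ↑ ζ`, the mean number `λ̃ Λ` of *active* base
stations with so strong a link vanishes: the serving base station is asymptotically inactive, and
the interference has the limit law of the total power.

The fading gain of the serving link is exponential and independent of the interference `I`, so with
serving path loss frozen at `z` the coverage probability is `E[exp (-(γ / (P z)) (I + P_N))]`. This
changes by at most `t - 1` when `z` is replaced by `z / t`, uniformly in `λ`, which passes from the
frozen path loss `ζ` to the actual one.
-/

noncomputable section

namespace UDN

section NegExp

/-- `exp (-x)` as a function from `[0, ∞]` to itself, so that the Laplace transform of a random
variable with values in `[0, ∞]` is a lower Lebesgue integral. -/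
def negExp (x : ℝ≥0∞) : ℝ≥0∞ := EReal.exp (-(x : EReal))

/-- The inverse of `negExp` on `[0, 1]`. -/
def negLog (p : ℝ≥0∞) : ℝ≥0∞ := (-(ENNReal.log p)).toENNReal

@[simp]
lemma negExp_zero : negExp 0 = 1 := by simp [negExp]

@[simp]
lemma negExp_top : negExp ∞ = 0 := by simp [negExp]

lemma negExp_ofReal {x : ℝ} (hx : 0 ≤ x) :
    negExp (ENNReal.ofReal x) = ENNReal.ofReal (Real.exp (-x)) := by
  rw [negExp, EReal.coe_ennreal_ofReal, max_eq_left hx, ← EReal.coe_neg, EReal.exp_coe]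

lemma negExp_add (x y : ℝ≥0∞) : negExp (x + y) = negExp x * negExp y := by
  rw [negExp, negExp, negExp, EReal.coe_ennreal_add, ← EReal.exp_add,
    EReal.neg_add (.inl (EReal.coe_ennreal_ne_bot x)) (.inr (EReal.coe_ennreal_ne_bot y)),
    sub_eq_add_neg]

lemma negExp_sum {ι : Type*} (s : Finset ι) (f : ι → ℝ≥0∞) :
    negExp (∑ i ∈ s, f i) = ∏ i ∈ s, negExp (f i) := by
  classical
  induction s using Finset.induction_on with
  | empty => simp
  | insert a s ha ih => rw [Finset.sum_insert ha, Finset.prod_insert ha, negExp_add, ih]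

lemma negExp_natCast_mul (n : ℕ) (x : ℝ≥0∞) : negExp (n * x) = negExp x ^ n := by
  simpa using negExp_sum (Finset.range n) fun _ => x

lemma antitone_negExp : Antitone negExp := fun x y h => by
  rw [negExp, negExp, EReal.exp_le_exp_iff, EReal.neg_le_neg_iff]
  exact EReal.coe_ennreal_le_coe_ennreal_iff.2 h

lemma negExp_le_one (x : ℝ≥0∞) : negExp x ≤ 1 := negExp_zero ▸ antitone_negExp (zero_le (a := x))

lemma negExp_ne_top (x : ℝ≥0∞) : negExp x ≠ ∞ := ((negExp_le_one x).trans_lt ENNReal.one_lt_top).ne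

lemma continuous_negExp : Continuous negExp :=
  ENNReal.continuous_exp.comp (continuous_neg.comp continuous_coe_ennreal_ereal)

@[fun_prop]
lemma measurable_negExp : Measurable negExp := continuous_negExp.measurable

lemma expNeg_eq_toReal_negExp (x : ℝ≥0∞) : expNeg x = (negExp x).toReal := by
  rw [expNeg]
  split_ifs with h
  · simp [h]
  · rw [← ENNReal.ofReal_toReal h, negExp_ofReal ENNReal.toReal_nonneg,
      ENNReal.toReal_ofReal (Real.exp_pos _).le, ENNReal.toReal_ofReal ENNReal.toReal_nonneg]

lemma negExp_negLog {p : ℝ≥0∞} (hp : p ≤ 1) : negExp (negLog p) = p := by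
  have h : (0 : EReal) ≤ -ENNReal.log p := by
    rw [EReal.le_neg, neg_zero]
    exact ENNReal.log_le_zero_iff.2 hp
  rw [negExp, negLog, EReal.coe_toENNReal h, neg_neg, ENNReal.exp_log]

@[fun_prop]
lemma measurable_negLog : Measurable negLog :=
  measurable_ereal_toENNReal.comp (continuous_neg.measurable.comp ENNReal.measurable_log)

lemma one_sub_negExp_le (x : ℝ≥0∞) : 1 - negExp x ≤ x := by
  by_cases h : x = ∞
  · simp [h]
  · rw [← ENNReal.ofReal_toReal h, negExp_ofReal ENNReal.toReal_nonneg, ← ENNReal.ofReal_one,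
      ← ENNReal.ofReal_sub _ (Real.exp_pos _).le]
    exact ENNReal.ofReal_le_ofReal (by linarith [Real.add_one_le_exp (-x.toReal)])

lemma exp_neg_le_exp_neg_mul_add {t x : ℝ} (ht : 1 ≤ t) :
    Real.exp (-x) ≤ Real.exp (-(t * x)) + (t - 1) := by
  have h_tangent : Real.exp (-x) * (1 - (t - 1) * x) ≤ Real.exp (-(t * x)) := by
    rw [show -(t * x) = -x + -((t - 1) * x) by ring, Real.exp_add]
    gcongr
    linarith [Real.add_one_le_exp (-((t - 1) * x))]
  have h_max : Real.exp (-x) * x ≤ 1 := by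
    rw [Real.exp_neg, inv_mul_le_iff₀ (Real.exp_pos x)]
    linarith [Real.add_one_le_exp x]
  nlinarith [mul_le_mul_of_nonneg_left h_max (sub_nonneg.2 ht)]

lemma negExp_le_negExp_mul_add {t : ℝ} (ht : 1 ≤ t) (x : ℝ≥0∞) :
    negExp x ≤ negExp (ENNReal.ofReal t * x) + ENNReal.ofReal (t - 1) := by
  by_cases h : x = ∞
  · simp [h]
  · have hx : 0 ≤ x.toReal := ENNReal.toReal_nonneg
    rw [← ENNReal.ofReal_toReal h, ← ENNReal.ofReal_mul (by positivity), negExp_ofReal hx,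
      negExp_ofReal (by positivity), ← ENNReal.ofReal_add (Real.exp_pos _).le (by linarith)]
    exact ENNReal.ofReal_le_ofReal (exp_neg_le_exp_neg_mul_add ht)

lemma tendsto_lintegral_negExp {Ω : Type*} [MeasurableSpace Ω] {μ : Measure Ω} [IsFiniteMeasure μ]
    {f : ℕ → Ω → ℝ≥0∞} {g : Ω → ℝ≥0∞} (hf : ∀ n, Measurable (f n))
    (hfg : ∀ ω, Tendsto (fun n => f n ω) atTop (𝓝 (g ω))) :
    Tendsto (fun n => ∫⁻ ω, negExp (f n ω) ∂μ) atTop (𝓝 (∫⁻ ω, negExp (g ω) ∂μ)) :=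
  tendsto_lintegral_of_dominated_convergence (fun _ => 1)
    (fun n => measurable_negExp.comp (hf n)) (fun _ => ae_of_all _ fun _ => negExp_le_one _)
    (by simp) (ae_of_all _ fun ω => (continuous_negExp.tendsto _).comp (hfg ω))

lemma lintegral_negExp_tsum_of_iIndepFun {Ω β : Type*} [MeasurableSpace Ω] [MeasurableSpace β]
    {μ : Measure Ω} {m : ℕ → Ω → β} (hm : ∀ i, Measurable (m i)) (hind : iIndepFun m μ)
    {F : ℕ → β → ℝ≥0∞} (hF : ∀ i, Measurable (F i)) {f : ℕ → ℝ≥0∞}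
    (hf : ∀ i, ∫⁻ ω, negExp (F i (m i ω)) ∂μ = negExp (f i)) :
    ∫⁻ ω, negExp (∑' i, F i (m i ω)) ∂μ = negExp (∑' i, f i) := by
  have := hind.isProbabilityMeasure
  have h_partial (n : ℕ) : ∫⁻ ω, negExp (∑ i ∈ Finset.range n, F i (m i ω)) ∂μ
      = negExp (∑ i ∈ Finset.range n, f i) := by
    simp_rw [negExp_sum, ← hf]
    exact lintegral_prod_eq_prod_lintegral_of_indepFun _ (fun i ω => negExp (F i (m i ω)))
      (hind.comp (fun i x => negExp (F i x)) fun i => measurable_negExp.comp (hF i))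
      fun i => measurable_negExp.comp ((hF i).comp (hm i))
  have h_lim := tendsto_lintegral_negExp (μ := μ)
    (f := fun n ω => ∑ i ∈ Finset.range n, F i (m i ω))
    (fun n => Finset.measurable_sum _ fun i _ => (hF i).comp (hm i))
    (fun ω => ENNReal.tendsto_nat_tsum fun i => F i (m i ω))
  simp_rw [h_partial] at h_lim
  exact tendsto_nhds_unique h_lim
    ((continuous_negExp.tendsto _).comp (ENNReal.tendsto_nat_tsum f))

end NegExp

section Distributions

lemma expMeasure_one_Ioi {a : ℝ} (ha : 0 ≤ a) :
    expMeasure 1 (Ioi a) = ENNReal.ofReal (Real.exp (-a)) := by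
  have := isProbabilityMeasure_expMeasure one_pos
  have h_cdf := cdf_expMeasure_eq one_pos a
  rw [cdf_eq_real, if_pos ha, one_mul] at h_cdf
  rw [← ofReal_measureReal, ← compl_Iic, probReal_compl_eq_one_sub measurableSet_Iic, h_cdf,
    sub_sub_cancel]

lemma expMeasure_one_lt_ofReal (a : ℝ≥0∞) :
    expMeasure 1 {x | a < ENNReal.ofReal x} = negExp a := by
  by_cases h : a = ∞
  · simp [h]
  · rw [← ENNReal.ofReal_toReal h, negExp_ofReal ENNReal.toReal_nonneg,
      ← expMeasure_one_Ioi ENNReal.toReal_nonneg]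
    simp_rw [ENNReal.ofReal_lt_ofReal_iff_of_nonneg ENNReal.toReal_nonneg]
    rfl

lemma expMeasure_one_eq_withDensity :
    expMeasure 1 =
      (volume.restrict (Ici 0)).withDensity fun x => ENNReal.ofReal (Real.exp (-x)) := by
  rw [← withDensity_indicator measurableSet_Ici]
  change volume.withDensity (exponentialPDF 1) = _
  congr 1
  ext x
  rw [exponentialPDF_eq]
  by_cases hx : 0 ≤ x <;> simp [hx]

lemma lintegral_negExp_expMeasure_one {a : ℝ} (ha : 0 ≤ a) :
    ∫⁻ x, negExp (ENNReal.ofReal (a * x)) ∂expMeasure 1 = ENNReal.ofReal (1 + a)⁻¹ := by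
  have h_exp : ∀ x ∈ Ici (0 : ℝ), ENNReal.ofReal (Real.exp (-x)) * negExp (ENNReal.ofReal (a * x))
      = ENNReal.ofReal (Real.exp (-(1 + a) * x)) := by
    intro x hx
    rw [negExp_ofReal (mul_nonneg ha hx), ← ENNReal.ofReal_mul (Real.exp_pos _).le, ← Real.exp_add]
    ring_nf
  rw [expMeasure_one_eq_withDensity,
    lintegral_withDensity_eq_lintegral_mul _ (by fun_prop) (by fun_prop)]
  simp only [Pi.mul_apply]
  rw [setLIntegral_congr_fun measurableSet_Ici h_exp, ← restrict_Ioi_eq_restrict_Ici,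
    ← ofReal_integral_eq_lintegral_ofReal (integrableOn_exp_mul_Ioi (by linarith) 0)
      (ae_of_all _ fun x => (Real.exp_pos _).le), integral_exp_mul_Ioi (by linarith), mul_zero,
    Real.exp_zero, neg_div_neg_eq, one_div]

lemma lintegral_negExp_poissonMeasure (r : ℝ≥0) (a : ℝ≥0∞) :
    ∫⁻ n : ℕ, negExp (a * n) ∂poissonMeasure r = negExp (r * (1 - negExp a)) := by
  obtain ⟨p, hp⟩ : ∃ p : ℝ≥0, negExp a = p := ⟨_, (ENNReal.coe_toNNReal (negExp_ne_top a)).symm⟩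
  have hp1 : p ≤ 1 := by exact_mod_cast hp ▸ negExp_le_one a
  have h_sum := (NormedSpace.expSeries_div_hasSum_exp (r * p : ℝ)).mul_left (Real.exp (-r))
  rw [← Real.exp_eq_exp_ℝ, ← Real.exp_add, show -(r : ℝ) + r * p = -(r * (1 - p)) by ring]
    at h_sum
  have h_rhs : (r : ℝ≥0∞) * (1 - p) = ENNReal.ofReal (r * (1 - p)) := by
    rw [ENNReal.ofReal_mul r.coe_nonneg, ENNReal.ofReal_sub _ p.coe_nonneg, ENNReal.ofReal_one]
    simp
  rw [hp, h_rhs, negExp_ofReal (mul_nonneg r.coe_nonneg (sub_nonneg.2 (by exact_mod_cast hp1))),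
    ← h_sum.tsum_eq, ENNReal.ofReal_tsum_of_nonneg (fun n => by positivity) h_sum.summable,
    lintegral_countable']
  refine tsum_congr fun n => ?_
  rw [mul_comm a, negExp_natCast_mul, hp, poissonMeasure_singleton, mul_comm,
    ← ENNReal.ofReal_coe_nnreal (p := p), ← ENNReal.ofReal_pow p.coe_nonneg,
    ← ENNReal.ofReal_mul (by positivity)]
  congr 1
  ring

end Distributions

section PointProcess

open Classical in
/-- The random measure attached to a point configuration: the sum of unit masses at those points
`x i` that are retained by the selection `a`. -/
def configuration {ι E : Type*} [MeasurableSpace E] (x : ι → E) (a : ι → Prop) : Measure E :=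
  Measure.sum fun i => if a i then Measure.dirac (x i) else 0

section Configuration

variable {ι E : Type*} [MeasurableSpace E]

open Classical in
lemma lintegral_configuration (x : ι → E) (a : ι → Prop) {f : E → ℝ≥0∞} (hf : Measurable f) :
    ∫⁻ y, f y ∂configuration x a = ∑' i, if a i then f (x i) else 0 := by
  rw [configuration, lintegral_sum_measure]
  refine tsum_congr fun i => ?_
  split_ifs
  · exact lintegral_dirac' _ hf
  · exact lintegral_zero_measure _

lemma configuration_apply (x : ι → E) (a : ι → Prop) {B : Set E} (hB : MeasurableSet B) :
    configuration x a B = {i | a i ∧ x i ∈ B}.encard := by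
  classical
  rw [← lintegral_indicator_one hB,
    lintegral_configuration x a (measurable_const.indicator hB : Measurable (B.indicator 1)),
    ← ENNReal.tsum_set_one, tsum_subtype {i | a i ∧ x i ∈ B} fun _ => (1 : ℝ≥0∞)]
  refine tsum_congr fun i => ?_
  by_cases ha : a i <;> by_cases hx : x i ∈ B <;> simp [ha, hx]

lemma measurable_lintegral_configuration {Ω : Type*} [Countable ι] [MeasurableSpace Ω]
    {X : ι → Ω → E} {A : ι → Ω → Prop} (hX : ∀ i, Measurable (X i)) (hA : ∀ i, Measurable (A i))
    {f : E → ℝ≥0∞} (hf : Measurable f) :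
    Measurable fun ω => ∫⁻ y, f y ∂configuration (X · ω) (A · ω) := by
  classical
  simp_rw [lintegral_configuration _ _ hf]
  exact Measurable.tsum fun i =>
    Measurable.ite (measurableSet_setOfPred.2 (hA i)) (hf.comp (hX i)) measurable_const

end Configuration

variable {Ω : Type*} [MeasurableSpace Ω] {μ : Measure Ω} {lam : ℝ}

section Counts

variable {N : Set Plane → Ω → ℕ∞}

lemma IsHPPP.iIndepFun {ι : Type*} [Finite ι] (hN : IsHPPP N lam μ) {B : ι → Set Plane}
    (hB : ∀ i, MeasurableSet (B i)) (hb : ∀ i, Bornology.IsBounded (B i))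
    (hd : Pairwise fun i j => Disjoint (B i) (B j)) : iIndepFun (fun i => N (B i)) μ := by
  have e := Finite.equivFin ι
  simpa using (hN.indep _ (fun j => B (e.symm j)) (fun _ => hB _) (fun _ => hb _)
    fun i j hij => hd (e.symm.injective.ne hij)).precomp e.injective

lemma IsHPPP.lintegral_negExp_count (hN : IsHPPP N lam μ) {B : Set Plane}
    (hB : MeasurableSet B) (hb : Bornology.IsBounded B) (a : ℝ≥0∞) :
    ∫⁻ ω, negExp (a * N B ω) ∂μ = negExp (ENNReal.ofReal lam * volume B * (1 - negExp a)) := by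
  have hf : Measurable fun n : ℕ∞ => negExp (a * n) := .of_discrete
  rw [(hN.law B hB hb).lintegral_comp hf.aemeasurable, lintegral_map hf .of_discrete]
  simp only [ENat.toENNReal_coe]
  rw [lintegral_negExp_poissonMeasure, ← ENNReal.ofReal, ENNReal.ofReal_mul' measureReal_nonneg,
    ofReal_measureReal hb.measure_lt_top.ne]

lemma IsHPPP.lintegral_negExp_sum_mul_count {ι : Type*} [Fintype ι] (hN : IsHPPP N lam μ)
    {B : ι → Set Plane} (hB : ∀ i, MeasurableSet (B i)) (hb : ∀ i, Bornology.IsBounded (B i))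
    (hd : Pairwise fun i j => Disjoint (B i) (B j))
    (hNm : ∀ i, Measurable fun ω => (N (B i) ω : ℝ≥0∞)) (a : ι → ℝ≥0∞) :
    ∫⁻ ω, negExp (∑ i, a i * N (B i) ω) ∂μ
      = negExp (ENNReal.ofReal lam * ∑ i, (1 - negExp (a i)) * volume (B i)) := by
  simp_rw [negExp_sum]
  rw [lintegral_prod_eq_prod_lintegral_of_indepFun _ (fun i ω => negExp (a i * N (B i) ω))
    ((hN.iIndepFun hB hb hd).comp (fun i n => negExp (a i * n)) fun _ => .of_discrete)
    fun i => measurable_negExp.comp ((hNm i).const_mul _)]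
  simp_rw [hN.lintegral_negExp_count (hB _) (hb _), ← negExp_sum, Finset.mul_sum, mul_assoc,
    mul_comm (volume _)]

end Counts

variable {X : ℕ → Ω → Plane} {A : ℕ → Ω → Prop}

lemma IsHPPP.lintegral_negExp_lintegral_simpleFunc
    (hN : IsHPPP (fun B ω => {i | A i ω ∧ X i ω ∈ B}.encard) lam μ)
    (hX : ∀ i, Measurable (X i)) (hA : ∀ i, Measurable (A i)) (g : SimpleFunc Plane ℝ≥0∞)
    (hg : Bornology.IsBounded (Function.support g)) :
    ∫⁻ ω, negExp (∫⁻ x, g x ∂configuration (X · ω) (A · ω)) ∂μ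
      = negExp (ENNReal.ofReal lam * ∫⁻ x, (1 - negExp (g x))) := by
  have h_count (ω : Ω) : ∫⁻ x, g x ∂configuration (X · ω) (A · ω)
      = ∑ c : ↥(g.range \ {0}), (c : ℝ≥0∞) * {i | A i ω ∧ X i ω ∈ g ⁻¹' {c.1}}.encard := by
    rw [SimpleFunc.lintegral_eq_lintegral, SimpleFunc.lintegral_eq_of_subset' _ subset_rfl,
      ← Finset.sum_coe_sort]
    simp_rw [configuration_apply _ _ (g.measurableSet_preimage _)]
  have h_volume : ∫⁻ x, (1 - negExp (g x))
      = ∑ c : ↥(g.range \ {0}), (1 - negExp c) * volume (g ⁻¹' {c.1}) := by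
    rw [Finset.sum_coe_sort _ fun c => (1 - negExp c) * volume (g ⁻¹' {c}),
      Finset.sum_subset Finset.sdiff_subset, ← SimpleFunc.map_lintegral,
      ← SimpleFunc.lintegral_eq_lintegral]
    · rfl
    · intro c hc hc'
      have : c = 0 := by simpa [hc] using hc'
      simp [this]
  simp_rw [h_count, h_volume]
  refine hN.lintegral_negExp_sum_mul_count (fun c => g.measurableSet_preimage _) (fun c => ?_)
    (fun c c' h => ?_) (fun c => ?_) _
  · refine hg.subset fun x (hx : g x = c) => ?_
    rw [Function.mem_support, hx]
    simpa using (Finset.mem_sdiff.1 c.2).2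
  · exact (disjoint_singleton.2 (Subtype.coe_injective.ne h)).preimage g
  · simpa only [lintegral_indicator_one (g.measurableSet_preimage _),
      configuration_apply _ _ (g.measurableSet_preimage _)] using
      measurable_lintegral_configuration hX hA
        (measurable_one.indicator (g.measurableSet_preimage {c.1}))

lemma exists_monotone_simpleFunc_isBounded_support {f : Plane → ℝ≥0∞} (hf : Measurable f) :
    ∃ g : ℕ → SimpleFunc Plane ℝ≥0∞, (∀ n, Bornology.IsBounded (Function.support (g n))) ∧
      Monotone g ∧ ∀ x, Tendsto (fun n => g n x) atTop (𝓝 (f x)) := by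
  have h_apply (n : ℕ) (x : Plane) : (SimpleFunc.eapprox f n).restrict (Metric.ball 0 n) x
      = (Metric.ball 0 n).indicator (SimpleFunc.eapprox f n) x :=
    SimpleFunc.restrict_apply _ measurableSet_ball x
  refine ⟨fun n => (SimpleFunc.eapprox f n).restrict (Metric.ball 0 n), fun n => ?_,
    fun m n hmn x => ?_, fun x => ?_⟩
  · refine (Metric.isBounded_ball (x := (0 : Plane)) (r := n)).subset fun x hx => ?_
    rw [Function.mem_support, h_apply] at hx
    exact mem_of_indicator_ne_zero hx
  · rw [h_apply, h_apply]
    exact (indicator_le_indicator (SimpleFunc.monotone_eapprox f hmn x)).trans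
      (indicator_le_indicator_of_subset (Metric.ball_subset_ball (Nat.cast_le.2 hmn))
        (fun _ => zero_le) x)
  · have h_eapprox : Tendsto (fun n => SimpleFunc.eapprox f n x) atTop (𝓝 (f x)) := by
      rw [← SimpleFunc.iSup_eapprox_apply hf x]
      exact tendsto_atTop_iSup fun m n hmn => SimpleFunc.monotone_eapprox f hmn x
    refine h_eapprox.congr' ?_
    filter_upwards [eventually_gt_atTop ⌈‖x‖⌉₊] with n hn
    rw [h_apply, indicator_of_mem (mem_ball_zero_iff.2 (Nat.lt_of_ceil_lt hn))]

theorem IsHPPP.lintegral_negExp_lintegral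
    (hN : IsHPPP (fun B ω => {i | A i ω ∧ X i ω ∈ B}.encard) lam μ) [IsFiniteMeasure μ]
    (hX : ∀ i, Measurable (X i)) (hA : ∀ i, Measurable (A i)) {f : Plane → ℝ≥0∞}
    (hf : Measurable f) :
    ∫⁻ ω, negExp (∫⁻ x, f x ∂configuration (X · ω) (A · ω)) ∂μ
      = negExp (ENNReal.ofReal lam * ∫⁻ x, (1 - negExp (f x))) := by
  obtain ⟨g, hgb, hgm, hgf⟩ := exists_monotone_simpleFunc_isBounded_support hf
  have h_left := tendsto_lintegral_negExp (μ := μ)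
    (fun n => measurable_lintegral_configuration hX hA (g n).measurable)
    (fun ω => lintegral_tendsto_of_tendsto_of_monotone (fun n => (g n).aemeasurable)
      (ae_of_all _ fun x m n hmn => hgm hmn x) (ae_of_all _ hgf))
  simp_rw [hN.lintegral_negExp_lintegral_simpleFunc hX hA _ (hgb _)] at h_left
  refine tendsto_nhds_unique h_left ((continuous_negExp.tendsto _).comp
    (ENNReal.Tendsto.const_mul ?_ (.inr ENNReal.ofReal_ne_top)))
  refine lintegral_tendsto_of_tendsto_of_monotone (fun n => by fun_prop)
    (ae_of_all _ fun x m n hmn => tsub_le_tsub_left (antitone_negExp (hgm hmn x)) _)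
    (ae_of_all _ fun x => ?_)
  exact ENNReal.Tendsto.sub tendsto_const_nhds
    ((continuous_negExp.tendsto _).comp (hgf x)) (.inl ENNReal.one_ne_top)

end PointProcess

section MarkedPointProcess

variable {Ω : Type*} [MeasurableSpace Ω] {μ : Measure Ω}

lemma lintegral_comp_of_indepFun {α β : Type*} [MeasurableSpace α] [MeasurableSpace β]
    [IsFiniteMeasure μ] {D : Ω → α} {m : Ω → β} (hD : Measurable D) (hm : Measurable m)
    (hind : IndepFun D m μ) {f : α × β → ℝ≥0∞} (hf : Measurable f) :
    ∫⁻ ω, f (D ω, m ω) ∂μ = ∫⁻ ω, ∫⁻ ω', f (D ω, m ω') ∂μ ∂μ := by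
  rw [← lintegral_map hf (hD.prodMk hm),
    (indepFun_iff_map_prod_eq_prod_map_map hD.aemeasurable hm.aemeasurable).1 hind,
    lintegral_prod _ hf.aemeasurable, lintegral_map hf.lintegral_prod_right' hD]
  exact lintegral_congr fun ω => lintegral_map (hf.comp measurable_prodMk_left) hm

/-- An independently marked homogeneous Poisson point process: the points `X i` selected by `A i`
form a homogeneous Poisson process of density `lam`, and the marks `m i` are i.i.d. with law `κ`
and independent of the points and of their selection. Unselected points carry marks as well. -/
structure IsMarkedHPPP {β : Type*} [MeasurableSpace β] (X : ℕ → Ω → Plane) (A : ℕ → Ω → Prop)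
    (m : ℕ → Ω → β) (lam : ℝ) (κ : Measure β) (μ : Measure Ω) : Prop where
  measurable_point : ∀ i, Measurable (X i)
  measurable_selection : ∀ i, Measurable (A i)
  measurable_mark : ∀ i, Measurable (m i)
  hppp : IsHPPP (fun B ω => {i | A i ω ∧ X i ω ∈ B}.encard) lam μ
  law_mark : ∀ i, HasLaw (m i) κ μ
  indep_mark : iIndepFun m μ
  indep_point_mark : IndepFun (fun ω i => (X i ω, A i ω)) (fun ω i => m i ω) μ

namespace IsMarkedHPPP

variable {β : Type*} [MeasurableSpace β] {X : ℕ → Ω → Plane} {A : ℕ → Ω → Prop}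
  {m : ℕ → Ω → β} {lam : ℝ} {κ : Measure β}

lemma isProbabilityMeasure_mark (h : IsMarkedHPPP X A m lam κ μ) : IsProbabilityMeasure κ :=
  (h.law_mark 0).isProbabilityMeasure_iff.1 h.indep_mark.isProbabilityMeasure

open Classical in
lemma lintegral_negExp_tsum (h : IsMarkedHPPP X A m lam κ μ) {F : Plane × β → ℝ≥0∞}
    (hF : Measurable F) :
    ∫⁻ ω, negExp (∑' i, if A i ω then F (X i ω, m i ω) else 0) ∂μ
      = negExp (ENNReal.ofReal lam * ∫⁻ x, (1 - ∫⁻ b, negExp (F (x, b)) ∂κ)) := by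
  have := h.indep_mark.isProbabilityMeasure
  have := h.isProbabilityMeasure_mark
  have h_meas : Measurable fun x => ∫⁻ b, negExp (F (x, b)) ∂κ :=
    (measurable_negExp.comp hF).lintegral_prod_right'
  have h_le (x : Plane) : ∫⁻ b, negExp (F (x, b)) ∂κ ≤ 1 :=
    (lintegral_mono fun b => negExp_le_one _).trans (by simp)
  have h_cond (ω : Ω) : ∫⁻ ω', negExp (∑' i, if A i ω then F (X i ω, m i ω') else 0) ∂μ
      = negExp (∑' i, if A i ω then negLog (∫⁻ b, negExp (F (X i ω, b)) ∂κ) else 0) := by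
    refine lintegral_negExp_tsum_of_iIndepFun h.measurable_mark h.indep_mark
      (F := fun i b => if A i ω then F (X i ω, b) else 0) (fun i => ?_) (fun i => ?_)
    · split_ifs
      exacts [hF.comp measurable_prodMk_left, measurable_const]
    · split_ifs
      · rw [negExp_negLog (h_le _)]
        exact (h.law_mark i).lintegral_comp (f := fun b => negExp (F (X i ω, b)))
          (measurable_negExp.comp (hF.comp measurable_prodMk_left)).aemeasurable
      · simp
  have h_fubini := lintegral_comp_of_indepFun (μ := μ)
    (measurable_pi_lambda _ fun i => (h.measurable_point i).prodMk (h.measurable_selection i))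
    (measurable_pi_lambda _ h.measurable_mark) h.indep_point_mark
    (f := fun p => negExp (∑' i, if (p.1 i).2 then F ((p.1 i).1, p.2 i) else 0))
    (measurable_negExp.comp <| Measurable.tsum fun i =>
      Measurable.ite (measurableSet_setOfPred.2 (by fun_prop)) (by fun_prop) measurable_const)
  have h_functional := h.hppp.lintegral_negExp_lintegral h.measurable_point h.measurable_selection
    (measurable_negLog.comp h_meas)
  simp_rw [lintegral_configuration _ _ (measurable_negLog.comp h_meas), Function.comp_apply,
    negExp_negLog (h_le _)] at h_functional
  simp_rw [h_fubini, h_cond, h_functional]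

lemma measure_forall_notMem (h : IsMarkedHPPP X A m lam κ μ) {E : Set (Plane × β)}
    (hE : MeasurableSet E) :
    μ {ω | ∀ i, A i ω → (X i ω, m i ω) ∉ E} = negExp (ENNReal.ofReal lam * (volume.prod κ) E) := by
  classical
  have := h.isProbabilityMeasure_mark
  have h_void_meas : MeasurableSet {ω | ∀ i, A i ω → (X i ω, m i ω) ∉ E} := by
    simp only [ofPred_forall]
    refine .iInter fun i => measurableSet_setOfPred.2 ((h.measurable_selection i).imp ?_)
    exact (measurableSet_setOfPred.1
      (((h.measurable_point i).prodMk (h.measurable_mark i)) hE)).not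
  have h_void (ω : Ω) :
      negExp (∑' i, if A i ω then E.indicator (fun _ => ∞) (X i ω, m i ω) else 0)
        = {ω | ∀ i, A i ω → (X i ω, m i ω) ∉ E}.indicator 1 ω := by
    by_cases hω : ∀ i, A i ω → (X i ω, m i ω) ∉ E
    · rw [indicator_of_mem (by exact hω), Pi.one_apply, ← negExp_zero, ENNReal.tsum_eq_zero.2]
      intro i
      split_ifs with hi
      exacts [indicator_of_notMem (hω i hi) _, rfl]
    · rw [indicator_of_notMem (by exact hω), ← negExp_top]
      push Not at hω
      obtain ⟨i, hA, hi⟩ := hω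
      rw [ENNReal.tsum_eq_top_of_eq_top ⟨i, by rw [if_pos hA, indicator_of_mem hi]⟩]
  have h_section (x : Plane) :
      1 - ∫⁻ b, negExp (E.indicator (fun _ => ∞) (x, b)) ∂κ = κ (Prod.mk x ⁻¹' E) := by
    have hb (b : β) :
        negExp (E.indicator (fun _ => ∞) (x, b)) = (Prod.mk x ⁻¹' E)ᶜ.indicator 1 b := by
      by_cases hb : (x, b) ∈ E <;> simp [hb]
    simp_rw [hb]
    rw [lintegral_indicator_one (measurable_prodMk_left hE).compl,
      prob_compl_eq_one_sub (measurable_prodMk_left hE),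
      ENNReal.sub_sub_cancel ENNReal.one_ne_top prob_le_one]
  rw [← lintegral_indicator_one h_void_meas, Measure.prod_apply hE]
  simp_rw [← h_void, ← h_section]
  exact h.lintegral_negExp_tsum (measurable_const.indicator hE)

end IsMarkedHPPP

end MarkedPointProcess

section SelectedExponential

variable {Ω : Type*} [MeasurableSpace Ω] {μ : Measure Ω}

lemma indepFun_restrict_of_disjoint {ι β : Type*} [MeasurableSpace β] {f : ι → Ω → β}
    (hf : ∀ i, Measurable (f i)) (hind : iIndepFun f μ) {s t : Set ι} (hst : Disjoint s t) :
    IndepFun (fun ω (i : s) => f i ω) (fun ω (i : t) => f i ω) μ := by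
  have h_le (u : Set ι) : MeasurableSpace.comap (fun ω (i : u) => f i ω) MeasurableSpace.pi
      ≤ ⨆ i ∈ u, MeasurableSpace.comap (f i) inferInstance := by
    rw [MeasurableSpace.pi, MeasurableSpace.comap_iSup]
    refine iSup_le fun i => ?_
    rw [MeasurableSpace.comap_comp]
    exact le_iSup₂_of_le i.1 i.2 le_rfl
  rw [IndepFun_iff_Indep]
  have h := indep_iSup_of_disjoint (fun i => (hf i).comap_le)
    ((iIndepFun_iff_iIndep _ _ _).1 hind) hst
  exact indep_of_indep_of_le_left (indep_of_indep_of_le_right h (h_le t)) (h_le s)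

lemma indepFun_prodMk_left_of_indepFun_prodMk_right {α β γ : Type*} [MeasurableSpace α]
    [MeasurableSpace β] [MeasurableSpace γ] [IsFiniteMeasure μ] {f : Ω → α} {g : Ω → β}
    {h : Ω → γ} (hf : Measurable f) (hg : Measurable g) (hh : Measurable h)
    (hfgh : IndepFun f (fun ω => (g ω, h ω)) μ) (hgh : IndepFun g h μ) :
    IndepFun (fun ω => (f ω, g ω)) h μ := by
  have hfg : IndepFun f g μ := hfgh.comp measurable_id measurable_fst
  rw [indepFun_iff_map_prod_eq_prod_map_map (hf.prodMk hg).aemeasurable hh.aemeasurable,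
    (indepFun_iff_map_prod_eq_prod_map_map hf.aemeasurable hg.aemeasurable).1 hfg]
  rw [indepFun_iff_map_prod_eq_prod_map_map hf.aemeasurable (hg.prodMk hh).aemeasurable,
    (indepFun_iff_map_prod_eq_prod_map_map hg.aemeasurable hh.aemeasurable).1 hgh,
    ← Measure.prodAssoc_prod] at hfgh
  apply MeasurableEquiv.prodAssoc.map_measurableEquiv_injective
  rw [← hfgh, Measure.map_map MeasurableEquiv.prodAssoc.measurable ((hf.prodMk hg).prodMk hh)]
  rfl

lemma measure_lt_ofReal_of_indepFun [IsFiniteMeasure μ] {W : Ω → ℝ≥0∞} {h : Ω → ℝ}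
    (hW : Measurable W) (hh : Measurable h) (hlaw : HasLaw h (expMeasure 1) μ)
    (hind : IndepFun W h μ) :
    μ {ω | W ω < ENNReal.ofReal (h ω)} = ∫⁻ ω, negExp (W ω) ∂μ := by
  have h_lt : MeasurableSet {p : ℝ≥0∞ × ℝ | p.1 < ENNReal.ofReal p.2} :=
    measurableSet_lt measurable_fst measurable_snd.ennreal_ofReal
  rw [← lintegral_indicator_one (measurableSet_lt hW hh.ennreal_ofReal)]
  refine (lintegral_comp_of_indepFun hW hh hind (measurable_one.indicator h_lt)).trans
    (lintegral_congr fun ω => ?_)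
  have h_tail : MeasurableSet {x : ℝ | W ω < ENNReal.ofReal x} := measurable_prodMk_left h_lt
  exact (lintegral_indicator_one (hh h_tail)).trans
    ((hlaw.measure_eq h_tail).trans (expMeasure_one_lt_ofReal _))

lemma measure_lt_ofReal_selected [IsFiniteMeasure μ] {ι : Type*} [Countable ι] [DecidableEq ι]
    [MeasurableSpace ι] [MeasurableSingletonClass ι] {T : Ω → ι} {W : Ω → ℝ≥0∞} {h : ι → Ω → ℝ}
    (hT : Measurable T) (hW : Measurable W) (hh : ∀ b, Measurable (h b))
    (hlaw : ∀ b, HasLaw (h b) (expMeasure 1) μ)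
    (hind : ∀ b, IndepFun (fun ω => if T ω = b then W ω else ∞) (h b) μ) :
    μ {ω | W ω < ENNReal.ofReal (h (T ω) ω)} = ∫⁻ ω, negExp (W ω) ∂μ := by
  have hWb (b : ι) : Measurable fun ω => if T ω = b then W ω else ∞ :=
    hW.ite (hT (measurableSet_singleton b)) measurable_const
  have h_eq {ω : Ω} {b : ι} (hb : (if T ω = b then W ω else ∞) < ENNReal.ofReal (h b ω)) :
      T ω = b :=
    of_not_not fun hne => not_top_lt (by rwa [if_neg hne] at hb)
  have h_union : {ω | W ω < ENNReal.ofReal (h (T ω) ω)}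
      = ⋃ b, {ω | (if T ω = b then W ω else ∞) < ENNReal.ofReal (h b ω)} := by
    ext ω
    simp only [mem_ofPred_eq, mem_iUnion]
    refine ⟨fun hω => ⟨T ω, by rwa [if_pos rfl]⟩, fun ⟨b, hb⟩ => ?_⟩
    obtain rfl := h_eq hb
    rwa [if_pos rfl] at hb
  have h_disj : Pairwise (Function.onFun Disjoint
      fun b => {ω | (if T ω = b then W ω else ∞) < ENNReal.ofReal (h b ω)}) :=
    fun b c hbc => disjoint_left.2 fun ω hb hc => hbc ((h_eq hb).symm.trans (h_eq hc))
  have h_sum (ω : Ω) : ∑' b, negExp (if T ω = b then W ω else ∞) = negExp (W ω) := by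
    rw [tsum_eq_single (T ω) fun b hb => by rw [if_neg hb.symm, negExp_top], if_pos rfl]
  rw [h_union, measure_iUnion h_disj fun b => measurableSet_lt (hWb b) (hh b).ennreal_ofReal]
  simp_rw [measure_lt_ofReal_of_indepFun (hWb _) (hh _) (hlaw _) (hind _)]
  exact (lintegral_tsum fun b => (measurable_negExp.comp (hWb b)).aemeasurable).symm.trans
    (lintegral_congr h_sum)

end SelectedExponential

section RadialIntegration

lemma lintegral_norm_plane {f : ℝ → ℝ≥0∞} (hf : Measurable f) :
    ∫⁻ x : Plane, f ‖x‖ = ENNReal.ofReal (2 * Real.pi) *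
      ∫⁻ u in Ioi (0 : ℝ), ENNReal.ofReal u * f u := by
  calc ∫⁻ x : Plane, f ‖x‖
      = ∫⁻ z : ℂ, f ‖z‖ := by
        simpa only [LinearIsometryEquiv.norm_map] using
          (Complex.orthonormalBasisOneI.measurePreserving_repr.lintegral_comp
            (f := fun x => f ‖x‖) (by fun_prop)).symm
    _ = ∫⁻ p in Ioi (0 : ℝ) ×ˢ Ioo (-Real.pi) Real.pi, ENNReal.ofReal p.1 * f p.1 := by
        rw [← Complex.lintegral_comp_polarCoord_symm]
        refine setLIntegral_congr_fun (measurableSet_Ioi.prod measurableSet_Ioo) fun p hp => ?_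
        simp only [Complex.norm_polarCoord_symm, abs_of_pos (show 0 < p.1 from hp.1), smul_eq_mul]
    _ = ∫⁻ u in Ioi (0 : ℝ), ENNReal.ofReal u * f u * ENNReal.ofReal (2 * Real.pi) := by
        rw [Measure.volume_eq_prod, ← Measure.prod_restrict,
          lintegral_prod _ (by fun_prop)]
        simp only [lintegral_const, Measure.restrict_apply_univ, Real.volume_Ioo, sub_neg_eq_add,
          ← two_mul]
    _ = ENNReal.ofReal (2 * Real.pi) * ∫⁻ u in Ioi (0 : ℝ), ENNReal.ofReal u * f u := by
        rw [lintegral_mul_const _ (by fun_prop), mul_comm]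

end RadialIntegration

section LinkModel

/-- The joint law of the marks of a link: the variable that decides whether the link is LoS, uniform
on `[0, 1]`, and the fading gain, exponential with mean one. -/
def markLaw : Measure (ℝ × ℝ) := (volume.restrict (Icc (0 : ℝ) 1)).prod (expMeasure 1)

instance : IsProbabilityMeasure (volume.restrict (Icc (0 : ℝ) 1)) := ⟨by simp⟩

instance : IsProbabilityMeasure (expMeasure 1) := isProbabilityMeasure_expMeasure one_pos

instance : IsProbabilityMeasure markLaw := by
  unfold markLaw
  infer_instance

lemma setLIntegral_Icc_zero_one_ite_lt {p : ℝ} (hp : p ∈ Icc (0 : ℝ) 1) (a b : ℝ≥0∞) :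
    ∫⁻ u in Icc (0 : ℝ) 1, (if u < p then a else b)
      = ENNReal.ofReal p * a + ENNReal.ofReal (1 - p) * b := by
  have h_below : Iio p ∩ Icc 0 1 = Ico 0 p := by
    ext u
    exact ⟨fun h => ⟨h.2.1, h.1⟩, fun h => ⟨h.2, h.1, h.2.le.trans hp.2⟩⟩
  have h_above : (Iio p)ᶜ ∩ Icc 0 1 = Icc p 1 := by
    ext u
    exact ⟨fun h => ⟨not_lt.1 h.1, h.2.2⟩, fun h => ⟨not_lt.2 h.1, hp.1.trans h.1, h.2⟩⟩
  refine (lintegral_piecewise measurableSet_Iio (fun _ => a) (fun _ => b)).trans ?_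
  rw [setLIntegral_const, setLIntegral_const, Measure.restrict_apply measurableSet_Iio,
    Measure.restrict_apply measurableSet_Iio.compl, h_below, h_above, Real.volume_Ico,
    Real.volume_Icc, sub_zero, mul_comm a, mul_comm b]

namespace PathLoss

variable {k : ℕ} {M : PathLoss k} {r u z ζ : ℝ}

lemma le_dist3 (M : PathLoss k) (r : ℝ) : M.L ≤ M.dist3 r :=
  Real.le_sqrt_of_sq_le (le_add_of_nonneg_left (sq_nonneg r))

lemma self_le_dist3 (M : PathLoss k) (r : ℝ) : r ≤ M.dist3 r :=
  Real.le_sqrt_of_sq_le (le_add_of_nonneg_right (sq_nonneg M.L))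

lemma continuous_dist3 (M : PathLoss k) : Continuous M.dist3 := by
  unfold dist3
  fun_prop

lemma injOn_dist3 (M : PathLoss k) : InjOn M.dist3 (Ici 0) := by
  intro a ha b hb hab
  rw [dist3, dist3, Real.sqrt_inj (by positivity) (by positivity), add_left_inj] at hab
  exact (pow_left_inj₀ ha hb two_ne_zero).1 hab

lemma monotone_piece (M : PathLoss k) : Monotone M.piece := by
  intro a b hab
  refine Fin.mk_le_mk.2 (Finset.card_le_card fun n hn => ?_)
  simp only [Finset.mem_filter, Finset.mem_univ, true_and] at hn ⊢
  exact hn.trans_le hab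

lemma measurable_apply_piece (M : PathLoss k) {f : Fin (k + 1) → ℝ → ℝ}
    (hf : ∀ n, Measurable (f n)) : Measurable fun w => f (M.piece w) w := by
  have h_piece : Measurable M.piece := measurable_to_countable' fun n =>
    (ordConnected_singleton.preimage_mono M.monotone_piece).measurableSet
  have h_uncurry : Measurable fun p : Fin (k + 1) × ℝ => f p.1 p.2 :=
    measurable_from_prod_countable_right hf
  exact h_uncurry.comp (h_piece.prodMk measurable_id)

lemma measurable_zetaL (M : PathLoss k) : Measurable M.zetaL :=
  M.measurable_apply_piece fun n => by
    unfold zetaPieceL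
    fun_prop

lemma measurable_zetaNL (M : PathLoss k) : Measurable M.zetaNL :=
  M.measurable_apply_piece fun n => by
    unfold zetaPieceNL
    fun_prop

lemma Valid.PrL_mem (hM : M.Valid) (r : ℝ) : M.PrL (M.dist3 r) ∈ Icc (0 : ℝ) 1 :=
  hM.prL_mem _ _ (M.le_dist3 r) rfl

lemma Valid.measurable_PrL_dist3 (hM : M.Valid) : Measurable fun r => M.PrL (M.dist3 r) := by
  have h_ext (n : Fin (k + 1)) :
      ∃ g : ℝ → ℝ, Antitone g ∧ EqOn (M.prL n) g {w | M.L ≤ w ∧ M.piece w = n} := by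
    refine (hM.prL_anti n).exists_antitone_extension ⟨0, ?_⟩ ⟨1, ?_⟩
    · rintro _ ⟨w, hw, rfl⟩
      exact (hM.prL_mem n w hw.1 hw.2).1
    · rintro _ ⟨w, hw, rfl⟩
      exact (hM.prL_mem n w hw.1 hw.2).2
  choose g hg_anti hg_eq using h_ext
  have h_eq : (fun r => M.PrL (M.dist3 r)) = fun r => g (M.piece (M.dist3 r)) (M.dist3 r) :=
    funext fun r => hg_eq _ ⟨M.le_dist3 r, rfl⟩
  rw [h_eq]
  exact (M.measurable_apply_piece fun n => (hg_anti n).measurable).comp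
    M.continuous_dist3.measurable

lemma Valid.zetaL_pos (hM : M.Valid) (r : ℝ) : 0 < M.zetaL (M.dist3 r) :=
  mul_pos (hM.AL_pos _) (Real.rpow_pos_of_pos (hM.L_pos.trans_le (M.le_dist3 r)) _)

lemma Valid.zetaNL_pos (hM : M.Valid) (r : ℝ) : 0 < M.zetaNL (M.dist3 r) :=
  mul_pos (hM.ANL_pos _) (Real.rpow_pos_of_pos (hM.L_pos.trans_le (M.le_dist3 r)) _)

open Classical in
/-- The path loss of a link of 2D distance `r` whose LoS variable is `u`. -/
def gain (M : PathLoss k) (r u : ℝ) : ℝ :=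
  if u < M.PrL (M.dist3 r) then M.zetaL (M.dist3 r) else M.zetaNL (M.dist3 r)

lemma gain_eq_or (M : PathLoss k) (r u : ℝ) :
    M.gain r u = M.zetaL (M.dist3 r) ∨ M.gain r u = M.zetaNL (M.dist3 r) :=
  ite_eq_or_eq _ _ _

lemma Valid.gain_pos (hM : M.Valid) (r u : ℝ) : 0 < M.gain r u := by
  rcases M.gain_eq_or r u with h | h <;> rw [h]
  exacts [hM.zetaL_pos r, hM.zetaNL_pos r]

lemma Valid.measurable_gain (hM : M.Valid) : Measurable fun p : ℝ × ℝ => M.gain p.1 p.2 :=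
  Measurable.ite (measurableSet_lt measurable_snd (hM.measurable_PrL_dist3.comp measurable_fst))
    ((M.measurable_zetaL.comp M.continuous_dist3.measurable).comp measurable_fst)
    ((M.measurable_zetaNL.comp M.continuous_dist3.measurable).comp measurable_fst)

lemma Valid.lintegral_negExp_gain (hM : M.Valid) {c : ℝ} (hc : 0 ≤ c) (r : ℝ) :
    ∫⁻ b, negExp (ENNReal.ofReal (c * M.gain r b.1 * b.2)) ∂markLaw
      = ENNReal.ofReal (M.PrL (M.dist3 r)) * ENNReal.ofReal (1 + c * M.zetaL (M.dist3 r))⁻¹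
        + ENNReal.ofReal (1 - M.PrL (M.dist3 r))
          * ENNReal.ofReal (1 + c * M.zetaNL (M.dist3 r))⁻¹ := by
  classical
  have h_gain : Measurable fun b : ℝ × ℝ => M.gain r b.1 :=
    hM.measurable_gain.comp (measurable_const.prodMk measurable_fst)
  have h_fading (u : ℝ) :
      ∫⁻ y, negExp (ENNReal.ofReal (c * M.gain r u * y)) ∂expMeasure 1
        = if u < M.PrL (M.dist3 r) then ENNReal.ofReal (1 + c * M.zetaL (M.dist3 r))⁻¹
          else ENNReal.ofReal (1 + c * M.zetaNL (M.dist3 r))⁻¹ := by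
    rw [lintegral_negExp_expMeasure_one (mul_nonneg hc (hM.gain_pos r u).le), gain]
    split_ifs <;> rfl
  rw [markLaw, lintegral_prod _ (by fun_prop), ← setLIntegral_Icc_zero_one_ite_lt (hM.PrL_mem r)]
  exact lintegral_congr h_fading

lemma Valid.one_sub_lintegral_negExp_gain (hM : M.Valid) {c : ℝ} (hc : 0 < c) (r : ℝ) :
    1 - ∫⁻ b, negExp (ENNReal.ofReal (c * M.gain r b.1 * b.2)) ∂markLaw
      = ENNReal.ofReal (M.PrL (M.dist3 r) / (1 + (c * M.zetaL (M.dist3 r))⁻¹))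
        + ENNReal.ofReal ((1 - M.PrL (M.dist3 r)) / (1 + (c * M.zetaNL (M.dist3 r))⁻¹)) := by
  rw [hM.lintegral_negExp_gain hc.le]
  have h_mem := hM.PrL_mem r
  have hL := mul_pos hc (hM.zetaL_pos r)
  have hNL := mul_pos hc (hM.zetaNL_pos r)
  generalize M.PrL (M.dist3 r) = p at *
  generalize c * M.zetaL (M.dist3 r) = a at *
  generalize c * M.zetaNL (M.dist3 r) = b at *
  have hp : 0 ≤ p := h_mem.1
  have hp' : 0 ≤ 1 - p := sub_nonneg.2 h_mem.2
  rw [← ENNReal.ofReal_mul hp, ← ENNReal.ofReal_mul hp',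
    ← ENNReal.ofReal_add (by positivity) (by positivity),
    ← ENNReal.ofReal_add (by positivity) (by positivity), ← ENNReal.ofReal_one,
    ← ENNReal.ofReal_sub _ (by positivity)]
  congr 1
  field_simp
  ring

/-- The Laplace transform at `s` of the total power received from a Poisson process of density
`lam` is `exp (-lam * laplaceExponent P s)`. -/
def laplaceExponent (M : PathLoss k) (P s : ℝ) : ℝ≥0∞ :=
  ENNReal.ofReal (2 * Real.pi) * (M.integralL P s + M.integralNL P s)

lemma limitLaplace_eq_toReal_negExp (M : PathLoss k) (P s : ℝ) {rho : ℝ} (hrho : 0 ≤ rho) :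
    M.limitLaplace P rho s = (negExp (ENNReal.ofReal rho * M.laplaceExponent P s)).toReal := by
  rw [limitLaplace, expNeg_eq_toReal_negExp, expNeg_eq_toReal_negExp, ← ENNReal.toReal_mul,
    ← negExp_add, ← mul_add, mul_comm _ rho, ENNReal.ofReal_mul hrho, mul_assoc, laplaceExponent]

lemma Valid.lintegral_one_sub_lintegral_negExp_gain (hM : M.Valid) {P s : ℝ} (hsP : 0 < s * P) :
    ∫⁻ x : Plane, (1 - ∫⁻ b, negExp (ENNReal.ofReal (s * P * M.gain ‖x‖ b.1 * b.2)) ∂markLaw)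
      = M.laplaceExponent P s := by
  have h_PrL := hM.measurable_PrL_dist3
  have h_L := M.measurable_zetaL.comp M.continuous_dist3.measurable
  have h_NL := M.measurable_zetaNL.comp M.continuous_dist3.measurable
  simp only [Function.comp_def] at h_L h_NL
  have h_meas : Measurable fun r =>
      ENNReal.ofReal (M.PrL (M.dist3 r) / (1 + (s * P * M.zetaL (M.dist3 r))⁻¹))
        + ENNReal.ofReal ((1 - M.PrL (M.dist3 r)) / (1 + (s * P * M.zetaNL (M.dist3 r))⁻¹)) := by
    fun_prop
  simp_rw [hM.one_sub_lintegral_negExp_gain hsP]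
  rw [lintegral_norm_plane h_meas, laplaceExponent, integralL, integralNL,
    ← lintegral_add_left (by fun_prop)]
  congr 1
  refine setLIntegral_congr_fun measurableSet_Ioi fun u (hu : 0 < u) => ?_
  simp only [mul_add, ← ENNReal.ofReal_mul hu.le, mul_comm u, div_mul_eq_mul_div]

lemma Valid.eventually_gain_lt (hM : M.Valid) (hz : 0 < z) :
    ∀ᶠ r in atTop, ∀ u, M.gain r u < z := by
  have h_power (A : ℝ) {a : ℝ} (ha : 0 < a) : ∀ᶠ w : ℝ in atTop, A * w ^ (-a) < z := by
    have h := (tendsto_rpow_neg_atTop ha).const_mul A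
    rw [mul_zero] at h
    exact h.eventually (gt_mem_nhds hz)
  have h_dist3 : Tendsto M.dist3 atTop atTop := tendsto_atTop_mono M.self_le_dist3 tendsto_id
  filter_upwards [h_dist3.eventually (eventually_all.2 fun n => h_power (M.AL n) (hM.aL_pos n)),
    h_dist3.eventually (eventually_all.2 fun n => h_power (M.ANL n) (hM.aNL_pos n))]
    with r hL hNL u
  rcases M.gain_eq_or r u with h | h <;> rw [h]
  exacts [hL _, hNL _]

/-- The pairs of a position and a mark for which the path loss is at least `z`. -/
def strongLinks (M : PathLoss k) (z : ℝ) : Set (Plane × (ℝ × ℝ)) :=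
  {p | z ≤ M.gain ‖p.1‖ p.2.1}

lemma Valid.measurableSet_strongLinks (hM : M.Valid) (z : ℝ) :
    MeasurableSet (M.strongLinks z) :=
  measurableSet_le measurable_const <|
    hM.measurable_gain.comp (measurable_fst.norm.prodMk (measurable_fst.comp measurable_snd))

lemma Valid.measure_strongLinks_ne_top (hM : M.Valid) (hz : 0 < z) :
    (volume.prod markLaw) (M.strongLinks z) ≠ ∞ := by
  obtain ⟨R, hR⟩ := eventually_atTop.1 (hM.eventually_gain_lt hz)
  have h_subset : M.strongLinks z ⊆ Metric.closedBall 0 R ×ˢ univ := by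
    refine fun p hp => ⟨mem_closedBall_zero_iff.2 (le_of_lt ?_), mem_univ _⟩
    by_contra! h_far
    exact (hR _ h_far _).not_ge hp
  refine measure_ne_top_of_subset h_subset ?_
  rw [Measure.prod_prod, measure_univ, mul_one]
  exact measure_closedBall_lt_top.ne

lemma Valid.volume_level_eq_zero (hM : M.Valid) {A a : ℝ} (hA : A ≠ 0) (ha : a ≠ 0) (z : ℝ) :
    volume {x : Plane | A * M.dist3 ‖x‖ ^ (-a) = z} = 0 := by
  rcases eq_empty_or_nonempty {x : Plane | A * M.dist3 ‖x‖ ^ (-a) = z} with h | ⟨y, hy⟩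
  · rw [h, measure_empty]
  refine measure_mono_null (fun x hx => ?_) (Measure.addHaar_sphere volume (0 : Plane) ‖y‖)
  have h_pos (r : ℝ) : 0 < M.dist3 r := hM.L_pos.trans_le (M.le_dist3 r)
  have h_dist3 : M.dist3 ‖x‖ = M.dist3 ‖y‖ :=
    (Real.rpow_left_inj (h_pos _).le (h_pos _).le (neg_ne_zero.2 ha)).1
      (mul_left_cancel₀ hA (Eq.trans hx (Eq.symm hy)))
  exact mem_sphere_zero_iff_norm.2 (M.injOn_dist3 (norm_nonneg x) (norm_nonneg y) h_dist3)

lemma Valid.measure_gain_eq_eq_zero (hM : M.Valid) (z : ℝ) :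
    (volume.prod markLaw) {p : Plane × (ℝ × ℝ) | M.gain ‖p.1‖ p.2.1 = z} = 0 := by
  let level : Set Plane := ⋃ n, {x | M.zetaPieceL n (M.dist3 ‖x‖) = z} ∪
    {x | M.zetaPieceNL n (M.dist3 ‖x‖) = z}
  have h_level : volume level = 0 := measure_iUnion_null fun n => measure_union_null
    (hM.volume_level_eq_zero (hM.AL_pos n).ne' (hM.aL_pos n).ne' z)
    (hM.volume_level_eq_zero (hM.ANL_pos n).ne' (hM.aNL_pos n).ne' z)
  refine measure_mono_null (t := level ×ˢ univ) (fun p (hp : _ = z) => ⟨mem_iUnion.2 ?_, trivial⟩)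
    (by rw [Measure.prod_prod, h_level, zero_mul])
  exact ⟨M.piece (M.dist3 ‖p.1‖), (M.gain_eq_or _ _).imp (fun h => h.symm.trans hp)
    fun h => h.symm.trans hp⟩

/-- `ζ` is the peak path loss: no link exceeds it, and links come arbitrarily close to it with
positive intensity. -/
structure IsPeakPathLoss (M : PathLoss k) (ζ : ℝ) : Prop where
  pos : 0 < ζ
  gain_le : ∀ r u, M.gain r u ≤ ζ
  measure_strongLinks_pos : ∀ z < ζ, 0 < (volume.prod markLaw) (M.strongLinks z)

lemma Valid.tendsto_measure_strongLinks (hM : M.Valid) (hζ : M.IsPeakPathLoss ζ) :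
    Tendsto (fun t => (volume.prod markLaw) (M.strongLinks (ζ / t))) (𝓝[>] 1) (𝓝 0) := by
  have h_pos {t : ℝ} (ht : 1 < t) : 0 < t := one_pos.trans ht
  have h_inter : (volume.prod markLaw) (⋂ t > 1, M.strongLinks (ζ / t)) = 0 := by
    refine measure_mono_null (fun p hp => (hζ.gain_le _ _).antisymm ?_)
      (hM.measure_gain_eq_eq_zero ζ)
    have h_lim : Tendsto (fun t => ζ / t) (𝓝[>] (1 : ℝ)) (𝓝 (ζ / 1)) :=
      (tendsto_const_nhds.div tendsto_id one_ne_zero).mono_left nhdsWithin_le_nhds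
    rw [div_one] at h_lim
    refine le_of_tendsto h_lim ?_
    filter_upwards [self_mem_nhdsWithin] with t ht
    exact mem_iInter₂.1 hp t ht
  rw [← h_inter]
  refine tendsto_measure_biInter_gt
    (fun t _ => (hM.measurableSet_strongLinks _).nullMeasurableSet)
    (fun t t' ht htt' p hp => ?_)
    ⟨2, one_lt_two, hM.measure_strongLinks_ne_top (half_pos hζ.pos)⟩
  exact (div_le_div_of_nonneg_left hζ.pos.le (h_pos ht) htt').trans hp

lemma Valid.eventually_le_gain (hM : M.Valid)
    (hLoS : ∃ w, M.L < w ∧ M.piece w = 0 ∧ 0 < M.prL 0 w) (hz : z < M.zetaPieceL 0 M.L) :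
    ∃ p > 0, ∀ᶠ x : Plane in 𝓝 0, ∀ u < p, z ≤ M.gain ‖x‖ u := by
  obtain ⟨w, hLw, hw0, hpw⟩ := hLoS
  have h_zero : M.dist3 ‖(0 : Plane)‖ = M.L := by
    rw [norm_zero, dist3, zero_pow two_ne_zero, zero_add, Real.sqrt_sq hM.L_pos.le]
  have h_dist3 : Tendsto (fun x : Plane => M.dist3 ‖x‖) (𝓝 0) (𝓝 M.L) :=
    h_zero ▸ (M.continuous_dist3.comp continuous_norm).tendsto 0
  have h_zeta : ContinuousAt (M.zetaPieceL 0) M.L :=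
    continuousAt_const.mul (Real.continuousAt_rpow_const _ _ (Or.inl hM.L_pos.ne'))
  refine ⟨M.prL 0 w, hpw, ?_⟩
  filter_upwards [h_dist3.eventually (gt_mem_nhds hLw),
    h_dist3.eventually (h_zeta.eventually (lt_mem_nhds hz))] with x hxw hxz u hu
  have h_piece : M.piece (M.dist3 ‖x‖) = 0 :=
    le_antisymm (hw0 ▸ M.monotone_piece hxw.le) (Fin.zero_le _)
  have h_PrL : M.prL 0 w ≤ M.PrL (M.dist3 ‖x‖) := by
    rw [PrL, h_piece]
    exact hM.prL_anti 0 ⟨M.le_dist3 _, h_piece⟩ ⟨hLw.le, hw0⟩ hxw.le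
  rw [gain, if_pos (hu.trans_le h_PrL), zetaL, h_piece]
  exact hxz.le

lemma Valid.isPeakPathLoss (hM : M.Valid)
    (hLoS : ∃ w, M.L < w ∧ M.piece w = 0 ∧ 0 < M.prL 0 w)
    (hdomL : ∀ w, M.L ≤ w → M.zetaL w ≤ M.zetaPieceL 0 M.L)
    (hdomNL : ∀ w, M.L ≤ w → M.zetaNL w ≤ M.zetaPieceL 0 M.L) :
    M.IsPeakPathLoss (M.zetaPieceL 0 M.L) where
  pos := mul_pos (hM.AL_pos 0) (Real.rpow_pos_of_pos hM.L_pos _)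
  gain_le r u := by
    rcases M.gain_eq_or r u with h | h <;> rw [h]
    exacts [hdomL _ (M.le_dist3 r), hdomNL _ (M.le_dist3 r)]
  measure_strongLinks_pos z hz := by
    obtain ⟨p, hp, h_near⟩ := hM.eventually_le_gain hLoS hz
    obtain ⟨ε, hε, h_ball⟩ := Metric.eventually_nhds_iff_ball.1 h_near
    have h_subset : Metric.ball (0 : Plane) ε ×ˢ (Iio p ×ˢ univ) ⊆ M.strongLinks z :=
      fun q hq => h_ball q.1 hq.1 q.2.1 hq.2.1
    have h_LoS : 0 < volume.restrict (Icc (0 : ℝ) 1) (Iio p) := by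
      rw [Measure.restrict_apply measurableSet_Iio]
      refine lt_of_lt_of_le ?_ (measure_mono (show Ioo 0 (min p 1) ⊆ _ from fun u hu =>
        ⟨hu.2.trans_le (min_le_left _ _), hu.1.le, hu.2.le.trans (min_le_right _ _)⟩))
      simpa using hp
    refine lt_of_lt_of_le ?_ (measure_mono h_subset)
    rw [Measure.prod_prod, markLaw, Measure.prod_prod, measure_univ, mul_one]
    exact ENNReal.mul_pos (Metric.measure_ball_pos volume _ hε).ne' h_LoS.ne'

end PathLoss

end LinkModel

section Measurability

lemma measurable_sInf_nat {Ω : Type*} [MeasurableSpace Ω] {p : ℕ → Ω → Prop}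
    (hp : ∀ i, MeasurableSet {ω | p i ω}) : Measurable fun ω => sInf {i | p i ω} := by
  refine measurable_of_Iic fun n => ?_
  have h_le : (fun ω => sInf {i | p i ω}) ⁻¹' Iic n
      = (⋃ i ≤ n, {ω | p i ω}) ∪ ⋂ i, {ω | p i ω}ᶜ := by
    ext ω
    simp only [mem_preimage, mem_Iic, mem_union, mem_iUnion, mem_iInter, mem_compl_iff,
      mem_ofPred_eq, exists_prop]
    by_cases hne : {i | p i ω}.Nonempty
    · refine ⟨fun h => Or.inl ⟨_, h, Nat.sInf_mem hne⟩, ?_⟩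
      rintro (⟨i, hi, hpi⟩ | h)
      exacts [(Nat.sInf_le hpi).trans hi, absurd hne.some_mem (h _)]
    · rw [not_nonempty_iff_eq_empty] at hne
      simp only [hne, Nat.sInf_empty, Nat.zero_le, true_iff]
      exact Or.inr (eq_empty_iff_forall_notMem.1 hne)
  rw [h_le]
  exact (MeasurableSet.iUnion fun i => .iUnion fun _ => hp i).union
    (.iInter fun i => (hp i).compl)

namespace Network

variable {Ω : Type*} [MeasurableSpace Ω] {S : Network Ω} {k : ℕ} {M : PathLoss k}

lemma measurable_pathLoss (hM : M.Valid) (hX : ∀ i, Measurable (S.X i))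
    (hU : ∀ i, Measurable (S.U i)) (i : ℕ) : Measurable (S.pathLoss M i) :=
  hM.measurable_gain.comp ((hX i).norm.prodMk (hU i))

lemma measurable_serving (hM : M.Valid) (hX : ∀ i, Measurable (S.X i))
    (hU : ∀ i, Measurable (S.U i)) : Measurable (S.serving M) := by
  refine measurable_sInf_nat fun i => ?_
  rw [ofPred_forall]
  exact .iInter fun j =>
    measurableSet_le (measurable_pathLoss hM hX hU j) (measurable_pathLoss hM hX hU i)

lemma measurable_interference (hM : M.Valid) (hX : ∀ i, Measurable (S.X i))
    (hactive : ∀ i, Measurable (S.active i)) (hU : ∀ i, Measurable (S.U i))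
    (hh : ∀ i, Measurable (S.h i)) (P : ℝ) : Measurable (S.interference M P) := by
  refine Measurable.tsum fun i => Measurable.ite ?_ ?_ measurable_const
  · exact (measurableSet_setOfPred.2 (hactive i)).inter
      (measurableSet_eq_fun measurable_const (measurable_serving hM hX hU)).compl
  · exact (((measurable_pathLoss hM hX hU i).const_mul P).mul (hh i)).ennreal_ofReal

lemma measurable_ite_serving_eq (hM : M.Valid) (hX : ∀ i, Measurable (S.X i))
    (hactive : ∀ i, Measurable (S.active i)) (hU : ∀ i, Measurable (S.U i)) {b : ℕ}
    (hh : ∀ i ≠ b, Measurable (S.h i)) (P : ℝ) {f : ℝ≥0∞ → ℝ≥0∞} (hf : Measurable f) :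
    Measurable fun ω => if S.serving M ω = b then f (S.interference M P ω) else ∞ := by
  -- The serving link does not interfere, so its fading gain may be replaced by `0`.
  let S₀ : Network Ω := { S with h := Function.update S.h b 0 }
  have h_fading (i : ℕ) : Measurable (S₀.h i) := by
    rcases eq_or_ne i b with rfl | hi
    · simpa only [S₀, Function.update_self] using measurable_zero
    · simpa only [S₀, Function.update_of_ne hi] using hh i hi
  classical
  have h_eq {ω : Ω} (hω : S.serving M ω = b) : S.interference M P ω = S₀.interference M P ω := by
    refine tsum_congr fun i => ite_congr rfl (fun hi => ?_) fun _ => rfl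
    have hib : i ≠ b := hω ▸ hi.2
    simp only [S₀, Function.update_of_ne hib]
    rfl
  have h_ite : (fun ω => if S.serving M ω = b then f (S.interference M P ω) else ∞)
      = fun ω => if S.serving M ω = b then f (S₀.interference M P ω) else ∞ := by
    ext ω
    split_ifs with hω
    exacts [congrArg f (h_eq hω), rfl]
  rw [h_ite]
  exact (hf.comp (measurable_interference (S := S₀) hM hX hactive hU h_fading P)).ite
    (measurable_serving hM hX hU (measurableSet_singleton b)) measurable_const

end Network

end Measurability

section CoverageGivenInterference

namespace Network

variable {Ω : Type*} [MeasurableSpace Ω] {μ : Measure Ω} {S : Network Ω} {q rho lam : ℝ}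

lemma Valid.isProbabilityMeasure (hS : S.Valid μ q rho lam) : IsProbabilityMeasure μ :=
  hS.indep_mark.isProbabilityMeasure

lemma Valid.hasLaw_U (hS : S.Valid μ q rho lam) (i : ℕ) :
    HasLaw (S.U i) (volume.restrict (Icc (0 : ℝ) 1)) μ :=
  measurePreserving_fst.comp_hasLaw (hS.law_mark i)

lemma Valid.hasLaw_h (hS : S.Valid μ q rho lam) (i : ℕ) : HasLaw (S.h i) (expMeasure 1) μ :=
  measurePreserving_snd.comp_hasLaw (hS.law_mark i)

lemma Valid.indepFun_U_h (hS : S.Valid μ q rho lam) (i : ℕ) : IndepFun (S.U i) (S.h i) μ := by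
  have := hS.isProbabilityMeasure
  exact (indepFun_iff_hasLaw_prodMk_prod (hS.hasLaw_U i) (hS.hasLaw_h i)).2 (hS.law_mark i)

lemma Valid.indepFun_h (hS : S.Valid μ q rho lam) (b : ℕ) :
    IndepFun (fun ω => ((fun i => (S.X i ω, S.active i ω),
      fun i : ({b}ᶜ : Set ℕ) => (S.U i ω, S.h i ω)), S.U b ω)) (S.h b) μ := by
  have := hS.isProbabilityMeasure
  have h_mark (i : ℕ) : Measurable fun ω => (S.U i ω, S.h i ω) :=
    (hS.measurable_U i).prodMk (hS.measurable_h i)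
  have h_deployment : Measurable fun ω i => (S.X i ω, S.active i ω) :=
    measurable_pi_lambda _ fun i => (hS.measurable_X i).prodMk (hS.measurable_active i)
  have h_others : Measurable fun ω (i : ({b}ᶜ : Set ℕ)) => (S.U i ω, S.h i ω) :=
    measurable_pi_lambda _ fun i => h_mark i
  have h_split : IndepFun (fun ω (i : ({b}ᶜ : Set ℕ)) => (S.U i ω, S.h i ω))
      (fun ω => (S.U b ω, S.h b ω)) μ :=
    (indepFun_restrict_of_disjoint h_mark hS.indep_mark disjoint_compl_left).comp
      (ψ := fun m => m ⟨b, mem_singleton b⟩) measurable_id (measurable_pi_apply _)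
  have h_marks : Measurable fun m : ℕ → ℝ × ℝ => ((fun i : ({b}ᶜ : Set ℕ) => m i), m b) :=
    (measurable_pi_lambda _ fun i => measurable_pi_apply _).prodMk (measurable_pi_apply b)
  exact indepFun_prodMk_left_of_indepFun_prodMk_right (h_deployment.prodMk h_others)
    (hS.measurable_U b) (hS.measurable_h b)
    (indepFun_prodMk_left_of_indepFun_prodMk_right h_deployment h_others (h_mark b)
      (hS.indep_deployment.comp measurable_id h_marks) h_split)
    (hS.indepFun_U_h b)

variable {k : ℕ} {M : PathLoss k}

lemma Valid.indepFun_ite_serving_eq (hS : S.Valid μ q rho lam) (hM : M.Valid) (P : ℝ)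
    {f : ℝ≥0∞ → ℝ≥0∞} (hf : Measurable f) (b : ℕ) :
    IndepFun (fun ω => if S.serving M ω = b then f (S.interference M P ω) else ∞) (S.h b) μ := by
  let Z : Ω → ((ℕ → Plane × Prop) × (({b}ᶜ : Set ℕ) → ℝ × ℝ)) × ℝ := fun ω =>
    ((fun i => (S.X i ω, S.active i ω), fun i => (S.U i ω, S.h i ω)), S.U b ω)
  have h_comap {γ : Type} [MeasurableSpace γ]
      {F : ((ℕ → Plane × Prop) × (({b}ᶜ : Set ℕ) → ℝ × ℝ)) × ℝ → γ} (hF : Measurable F) :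
      Measurable[MeasurableSpace.comap Z inferInstance] (F ∘ Z) := hF.comp (comap_measurable Z)
  refine indep_of_indep_of_le_left (hS.indepFun_h b) (Measurable.comap_le ?_)
  refine @measurable_ite_serving_eq Ω (MeasurableSpace.comap Z inferInstance) S k M hM
    (fun i => h_comap (F := fun z => (z.1.1 i).1) (by fun_prop))
    (fun i => h_comap (F := fun z => (z.1.1 i).2) (by fun_prop))
    (fun i => ?_) b (fun i hi => ?_) P f hf
  · rcases eq_or_ne i b with rfl | hi
    · exact h_comap measurable_snd
    · exact h_comap (F := fun z => (z.1.2 ⟨i, hi⟩).1) (by fun_prop)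
  · exact h_comap (F := fun z => (z.1.2 ⟨i, hi⟩).2) (by fun_prop)

lemma Valid.measure_lt_sinrWith (hS : S.Valid μ q rho lam) (hM : M.Valid) {P z g : ℝ}
    (hP : 0 < P) (hz : 0 < z) (hg : 0 < g) (PN : ℝ) :
    μ {ω | ENNReal.ofReal g < S.sinrWith M P PN z ω}
      = ∫⁻ ω, negExp (ENNReal.ofReal (g / (P * z)) *
          (S.interference M P ω + ENNReal.ofReal PN)) ∂μ := by
  have := hS.isProbabilityMeasure
  have hPz : 0 < P * z := mul_pos hP hz
  have h_threshold (ω : Ω) : ENNReal.ofReal g < S.sinrWith M P PN z ω ↔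
      ENNReal.ofReal (g / (P * z)) * (S.interference M P ω + ENNReal.ofReal PN)
        < ENNReal.ofReal (S.h (S.serving M ω) ω) := by
    rw [sinrWith, ENNReal.lt_div_iff_mul_lt (Or.inr ENNReal.ofReal_ne_top)
      (Or.inr (ENNReal.ofReal_pos.2 hg).ne'), ENNReal.ofReal_mul hPz.le,
      ENNReal.ofReal_div_of_pos hPz, mul_comm (ENNReal.ofReal g / _), ← mul_div_assoc,
      ENNReal.div_lt_iff (Or.inl (ENNReal.ofReal_pos.2 hPz).ne') (Or.inl ENNReal.ofReal_ne_top),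
      mul_comm (ENNReal.ofReal g), mul_comm (ENNReal.ofReal (P * z))]
  have h_affine : Measurable fun x =>
      ENNReal.ofReal (g / (P * z)) * (x + ENNReal.ofReal PN) := by fun_prop
  simp_rw [h_threshold]
  exact measure_lt_ofReal_selected (measurable_serving hM hS.measurable_X hS.measurable_U)
    (h_affine.comp (measurable_interference hM hS.measurable_X hS.measurable_active
      hS.measurable_U hS.measurable_h P)) hS.measurable_h hS.hasLaw_h
    (hS.indepFun_ite_serving_eq hM P h_affine)

end Network

end CoverageGivenInterference

section PowerComparison

namespace Network

variable {Ω : Type*} {k : ℕ} {S : Network Ω} {M : PathLoss k}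

open Classical in
/-- The power received by the typical user from all active base stations, the serving one included
if it is active: the aggregate interference in which no base station is left out. -/
def totalPower (S : Network Ω) (M : PathLoss k) (P : ℝ) (ω : Ω) : ℝ≥0∞ :=
  ∑' i : ℕ, if S.active i ω then ENNReal.ofReal (P * S.pathLoss M i ω * S.h i ω) else 0

lemma interference_le_totalPower (S : Network Ω) (M : PathLoss k) (P : ℝ) (ω : Ω) :
    S.interference M P ω ≤ S.totalPower M P ω := by
  refine ENNReal.tsum_le_tsum fun i => ?_
  split_ifs with h_interferes h_active h_active
  exacts [le_rfl, absurd h_interferes.1 h_active, zero_le, le_rfl]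

lemma interference_eq_totalPower {ω : Ω} (h : ¬ S.active (S.serving M ω) ω) (P : ℝ) :
    S.interference M P ω = S.totalPower M P ω := by
  refine tsum_congr fun i => ?_
  by_cases hi : S.active i ω
  · rw [if_pos hi, if_pos ⟨hi, fun h_serving => h (h_serving ▸ hi)⟩]
  · rw [if_neg hi, if_neg fun h_interferes => hi h_interferes.1]

lemma sinrWith_mono (S : Network Ω) (M : PathLoss k) {P : ℝ} (hP : 0 ≤ P) (PN : ℝ) (ω : Ω)
    {z z' : ℝ} (hz : 0 ≤ z) (hzz' : z ≤ z') :
    S.sinrWith M P PN z ω ≤ S.sinrWith M P PN z' ω := by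
  refine ENNReal.div_le_div_right ?_ _
  rw [ENNReal.ofReal_mul (mul_nonneg hP hz), ENNReal.ofReal_mul (mul_nonneg hP (hz.trans hzz'))]
  gcongr

end Network

end PowerComparison

section FixedDensity

namespace Network

variable {Ω : Type*} [MeasurableSpace Ω] {μ : Measure Ω} {S : Network Ω} {q rho lam : ℝ}

lemma Valid.isMarkedHPPP_active (hS : S.Valid μ q rho lam) :
    IsMarkedHPPP S.X S.active (fun i ω => (S.U i ω, S.h i ω)) (activeDensity q rho lam)
      markLaw μ where
  measurable_point := hS.measurable_X
  measurable_selection := hS.measurable_active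
  measurable_mark i := (hS.measurable_U i).prodMk (hS.measurable_h i)
  hppp := hS.hppp_active
  law_mark := hS.law_mark
  indep_mark := hS.indep_mark
  indep_point_mark := hS.indep_deployment

lemma Valid.isMarkedHPPP (hS : S.Valid μ q rho lam) :
    IsMarkedHPPP S.X (fun _ _ => True) (fun i ω => (S.U i ω, S.h i ω)) lam markLaw μ where
  measurable_point := hS.measurable_X
  measurable_selection _ := measurable_const
  measurable_mark i := (hS.measurable_U i).prodMk (hS.measurable_h i)
  hppp := by simpa only [true_and] using! hS.hppp
  law_mark := hS.law_mark
  indep_mark := hS.indep_mark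
  indep_point_mark := hS.indep_deployment.comp
    (φ := fun (d : ℕ → Plane × Prop) i => ((d i).1, True))
    (measurable_pi_lambda _ fun i => (measurable_pi_apply i).fst.prodMk measurable_const)
    measurable_id

variable {k : ℕ} {M : PathLoss k} {P PN s g z ζ : ℝ}

lemma Valid.lintegral_negExp_totalPower (hS : S.Valid μ q rho lam) (hM : M.Valid) (hP : 0 < P)
    (hs : 0 < s) :
    ∫⁻ ω, negExp (ENNReal.ofReal s * S.totalPower M P ω) ∂μ
      = negExp (ENNReal.ofReal (activeDensity q rho lam) * M.laplaceExponent P s) := by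
  classical
  have h_sum (ω : Ω) : ENNReal.ofReal s * S.totalPower M P ω = ∑' i, if S.active i ω then
      ENNReal.ofReal (s * P * M.gain ‖S.X i ω‖ (S.U i ω) * S.h i ω) else 0 := by
    rw [totalPower, ← ENNReal.tsum_mul_left]
    refine tsum_congr fun i => ?_
    rw [mul_ite, mul_zero, ← ENNReal.ofReal_mul hs.le, ← mul_assoc, ← mul_assoc]
    rfl
  have h_measurable : Measurable fun p : Plane × (ℝ × ℝ) =>
      ENNReal.ofReal (s * P * M.gain ‖p.1‖ p.2.1 * p.2.2) :=
    (((hM.measurable_gain.comp (measurable_fst.norm.prodMk measurable_snd.fst)).const_mul _).mul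
      measurable_snd.snd).ennreal_ofReal
  simp_rw [h_sum, hS.isMarkedHPPP_active.lintegral_negExp_tsum h_measurable,
    hM.lintegral_one_sub_lintegral_negExp_gain (mul_pos hs hP)]

lemma Valid.laplace_eq_toReal_lintegral (hS : S.Valid μ q rho lam) (hM : M.Valid) (P s : ℝ) :
    S.laplace M μ P s
      = (∫⁻ ω, negExp (ENNReal.ofReal s * S.interference M P ω) ∂μ).toReal := by
  have h_interference := measurable_interference hM hS.measurable_X hS.measurable_active
    hS.measurable_U hS.measurable_h P
  simp_rw [laplace, expNeg_eq_toReal_negExp]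
  exact integral_toReal (measurable_negExp.comp (h_interference.const_mul _)).aemeasurable
    (ae_of_all _ fun ω => (negExp_ne_top _).lt_top)

lemma Valid.measure_forall_pathLoss_lt (hS : S.Valid μ q rho lam) (hM : M.Valid) (z : ℝ) :
    μ {ω | ∀ i, S.pathLoss M i ω < z}
      = negExp (ENNReal.ofReal lam * (volume.prod markLaw) (M.strongLinks z)) := by
  rw [← hS.isMarkedHPPP.measure_forall_notMem (hM.measurableSet_strongLinks z)]
  congr 1 with ω
  exact forall_congr' fun i => ⟨fun h _ => h.not_ge, fun h => not_le.1 (h trivial)⟩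

lemma Valid.measure_exists_active_le (hS : S.Valid μ q rho lam) (hM : M.Valid) (z : ℝ) :
    μ {ω | ∃ i, S.active i ω ∧ z ≤ S.pathLoss M i ω}
      ≤ ENNReal.ofReal (activeDensity q rho lam)
        * (volume.prod markLaw) (M.strongLinks z) := by
  have := hS.isProbabilityMeasure
  have h_measurable : MeasurableSet {ω | ∃ i, S.active i ω ∧ z ≤ S.pathLoss M i ω} := by
    rw [ofPred_exists]
    exact .iUnion fun i => (measurableSet_setOfPred.2 (hS.measurable_active i)).inter
      (measurableSet_le measurable_const
        (measurable_pathLoss hM hS.measurable_X hS.measurable_U i))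
  have h_compl : {ω | ∃ i, S.active i ω ∧ z ≤ S.pathLoss M i ω}ᶜ
      = {ω | ∀ i, S.active i ω →
          (S.X i ω, (S.U i ω, S.h i ω)) ∉ M.strongLinks z} := by
    ext ω
    simp only [mem_compl_iff, mem_ofPred_eq, not_exists, not_and]
    rfl
  rw [← compl_compl {ω | _}, prob_compl_eq_one_sub h_measurable.compl, h_compl,
    hS.isMarkedHPPP_active.measure_forall_notMem (hM.measurableSet_strongLinks z)]
  exact one_sub_negExp_le _

lemma Valid.ae_finite_le_pathLoss (hS : S.Valid μ q rho lam) (hM : M.Valid) (hz : 0 < z) :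
    ∀ᵐ ω ∂μ, {i | z ≤ S.pathLoss M i ω}.Finite := by
  obtain ⟨R, hR⟩ := eventually_atTop.1 (hM.eventually_gain_lt hz)
  have h_law := hS.hppp.law _ (measurableSet_ball (x := (0 : Plane)) (ε := R))
    Metric.isBounded_ball
  have h_count : ∀ᵐ ω ∂μ, S.count (Metric.ball 0 R) ω ≠ ⊤ := by
    rw [h_law.ae_iff (p := (· ≠ ⊤)) .of_discrete,
      ae_map_iff Measurable.of_discrete.aemeasurable .of_discrete]
    exact ae_of_all _ ENat.natCast_ne_top
  filter_upwards [h_count] with ω hω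
  refine (encard_ne_top_iff.1 hω).subset fun i hi => mem_ball_zero_iff.2 ?_
  exact not_le.1 fun h => (hR _ h (S.U i ω)).not_ge hi

lemma Valid.ae_le_pathLoss_serving (hS : S.Valid μ q rho lam) (hM : M.Valid) (hz : 0 < z) :
    ∀ᵐ ω ∂μ, (∃ i, z ≤ S.pathLoss M i ω) → z ≤ S.pathLoss M (S.serving M ω) ω := by
  filter_upwards [hS.ae_finite_le_pathLoss hM hz] with ω h_finite h_nonempty
  obtain ⟨j, hj, h_max⟩ := exists_max_image _ (S.pathLoss M · ω) h_finite h_nonempty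
  have hj_max (i : ℕ) : S.pathLoss M i ω ≤ S.pathLoss M j ω := by
    by_cases hi : z ≤ S.pathLoss M i ω
    exacts [h_max i hi, (not_le.1 hi).le.trans hj]
  have h_serving : S.serving M ω ∈ {i : ℕ | ∀ j, S.pathLoss M j ω ≤ S.pathLoss M i ω} :=
    Nat.sInf_mem ⟨j, hj_max⟩
  exact hj.trans (h_serving j)

lemma Valid.measure_active_serving_le (hS : S.Valid μ q rho lam) (hM : M.Valid) (hz : 0 < z) :
    μ {ω | S.active (S.serving M ω) ω} ≤ μ {ω | ∀ i, S.pathLoss M i ω < z}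
      + ENNReal.ofReal (activeDensity q rho lam)
        * (volume.prod markLaw) (M.strongLinks z) := by
  refine le_trans ?_ (add_le_add_right (hS.measure_exists_active_le hM z) _)
  refine le_trans (measure_mono_ae ?_) (measure_union_le _ _)
  filter_upwards [hS.ae_le_pathLoss_serving hM hz] with ω h_strong h_active
  by_cases h : ∃ i, z ≤ S.pathLoss M i ω
  · exact Or.inr ⟨_, h_active, h_strong h⟩
  · exact Or.inl fun i => not_le.1 fun hi => h ⟨i, hi⟩

lemma Valid.lintegral_negExp_interference_le (hS : S.Valid μ q rho lam) (hM : M.Valid) (P s : ℝ) :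
    ∫⁻ ω, negExp (ENNReal.ofReal s * S.interference M P ω) ∂μ
      ≤ ∫⁻ ω, negExp (ENNReal.ofReal s * S.totalPower M P ω) ∂μ
        + μ {ω | S.active (S.serving M ω) ω} := by
  have h_uncurry : Measurable fun p : ℕ × Ω => S.active p.1 p.2 :=
    measurable_from_prod_countable_right hS.measurable_active
  have h_active : MeasurableSet {ω | S.active (S.serving M ω) ω} :=
    measurableSet_setOfPred.2 (h_uncurry.comp
      ((measurable_serving hM hS.measurable_X hS.measurable_U).prodMk measurable_id))
  rw [← lintegral_indicator_one h_active,
    ← lintegral_add_right _ (measurable_one.indicator h_active)]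
  refine lintegral_mono fun ω => ?_
  by_cases hω : ω ∈ {ω | S.active (S.serving M ω) ω}
  · rw [indicator_of_mem hω]
    exact (negExp_le_one _).trans le_add_self
  · rw [interference_eq_totalPower hω]
    exact le_self_add

lemma measure_lt_sinr_le (S : Network Ω) (μ : Measure Ω) (hM : M.Valid) (hP : 0 ≤ P)
    (hζ : ∀ r u, M.gain r u ≤ ζ) (PN g : ℝ) :
    μ {ω | ENNReal.ofReal g < S.sinr M P PN ω} ≤
      μ {ω | ENNReal.ofReal g < S.sinrWith M P PN ζ ω} :=
  measure_mono fun ω hω =>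
    hω.trans_le (sinrWith_mono S M hP PN ω (hM.gain_pos _ _).le (hζ _ _))

lemma Valid.measure_lt_sinrWith_le_mul (hS : S.Valid μ q rho lam) (hM : M.Valid) (hP : 0 < P)
    (hg : 0 < g) (hz : 0 < z) (PN : ℝ) {t : ℝ} (ht : 1 ≤ t) :
    μ {ω | ENNReal.ofReal g < S.sinrWith M P PN (t * z) ω} ≤
      μ {ω | ENNReal.ofReal g < S.sinrWith M P PN z ω} + ENNReal.ofReal (t - 1) := by
  have := hS.isProbabilityMeasure
  have ht_pos : 0 < t := one_pos.trans_le ht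
  have h_scale : g / (P * z) = t * (g / (P * (t * z))) := by field_simp
  rw [hS.measure_lt_sinrWith hM hP (mul_pos ht_pos hz) hg, hS.measure_lt_sinrWith hM hP hz hg,
    h_scale, ENNReal.ofReal_mul ht_pos.le]
  calc _ ≤ ∫⁻ ω, (negExp (ENNReal.ofReal t * (ENNReal.ofReal (g / (P * (t * z))) *
          (S.interference M P ω + ENNReal.ofReal PN))) + ENNReal.ofReal (t - 1)) ∂μ :=
        lintegral_mono fun ω => negExp_le_negExp_mul_add ht _
    _ = _ := by
        rw [lintegral_add_right _ measurable_const, lintegral_const, measure_univ, mul_one]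
        simp_rw [mul_assoc]

lemma Valid.measure_lt_sinrWith_le (hS : S.Valid μ q rho lam) (hM : M.Valid) (hP : 0 ≤ P)
    (hz : 0 < z) (PN g : ℝ) :
    μ {ω | ENNReal.ofReal g < S.sinrWith M P PN z ω} ≤
      μ {ω | ENNReal.ofReal g < S.sinr M P PN ω} + μ {ω | ∀ i, S.pathLoss M i ω < z} := by
  refine le_trans (measure_mono_ae ?_) (measure_union_le _ _)
  filter_upwards [hS.ae_le_pathLoss_serving hM hz] with ω h_strong h_cov
  by_cases h : ∃ i, z ≤ S.pathLoss M i ω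
  · exact Or.inl (h_cov.trans_le (sinrWith_mono S M hP PN ω hz.le (h_strong h)))
  · exact Or.inr fun i => not_le.1 fun hi => h ⟨i, hi⟩

end Network

end FixedDensity

section IteratedLimit

lemma tendsto_zero_of_eventually_le {α β : Type*} {l : Filter α} {l' : Filter β} [l'.NeBot]
    {f : α → ℝ≥0∞} {u : β → α → ℝ≥0∞} {v : β → ℝ≥0∞}
    (hu : ∀ᶠ b in l', Tendsto (u b) l (𝓝 (v b))) (hv : Tendsto v l' (𝓝 0))
    (hle : ∀ᶠ b in l', ∀ᶠ a in l, f a ≤ u b a) : Tendsto f l (𝓝 0) := by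
  refine ENNReal.tendsto_nhds_zero.2 fun ε hε => ?_
  obtain ⟨b, hub, hvb, hfb⟩ := (hu.and ((hv.eventually_lt_const hε).and hle)).exists
  filter_upwards [hub.eventually_lt_const hvb, hfb] with a hua hfa
  exact hfa.trans hua.le

end IteratedLimit

section DenseLimit

lemma hasDerivAt_inv_one_add_mul_rpow {q : ℝ} (hq : q ≠ 0) (rho : ℝ) :
    HasDerivAt (fun t => ((1 + rho / q * t) ^ q)⁻¹) (-rho) 0 := by
  have h_affine : HasDerivAt (fun t : ℝ => 1 + rho / q * t) (rho / q) 0 := by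
    simpa only [mul_one] using ((hasDerivAt_id' (0 : ℝ)).const_mul (rho / q)).const_add 1
  exact ((h_affine.rpow_const (p := q) (Or.inl (by simp))).fun_inv (by simp)).congr_deriv
    (by simp [hq])

lemma tendsto_activeDensity {q : ℝ} (hq : q ≠ 0) (rho : ℝ) :
    Tendsto (activeDensity q rho) atTop (𝓝 rho) := by
  -- `-activeDensity q rho lam` is a difference quotient at `0` with increment `lam⁻¹`.
  have h_slope := ((hasDerivAt_iff_tendsto_slope_zero.1
    (hasDerivAt_inv_one_add_mul_rpow hq rho)).mono_left (nhdsGT_le_nhdsNE 0)).comp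
      tendsto_inv_atTop_nhdsGT_zero
  rw [← neg_neg rho]
  refine h_slope.neg.congr fun lam => ?_
  simp only [Function.comp_apply, activeDensity, smul_eq_mul, inv_inv, zero_add, mul_zero,
    add_zero, Real.one_rpow, inv_one, one_div, neg_neg, ← div_eq_mul_inv, div_div]
  ring

namespace Network

variable {Ω : ℝ → Type*} [∀ lam, MeasurableSpace (Ω lam)] {μ : ∀ lam, Measure (Ω lam)}
  {S : ∀ lam, Network (Ω lam)} {k : ℕ} {M : PathLoss k} {q rho ζ P s g : ℝ}

lemma tendsto_measure_forall_pathLoss_lt (hM : M.Valid) (hζ : M.IsPeakPathLoss ζ)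
    (hS : ∀ᶠ lam in atTop, (S lam).Valid (μ lam) q rho lam) {z : ℝ} (hz : z < ζ) :
    Tendsto (fun lam => μ lam {ω | ∀ i, (S lam).pathLoss M i ω < z}) atTop (𝓝 0) := by
  have h_mean : Tendsto (fun lam => ENNReal.ofReal lam * (volume.prod markLaw) (M.strongLinks z))
      atTop (𝓝 ⊤) := by
    rw [← ENNReal.top_mul (hζ.measure_strongLinks_pos z hz).ne']
    exact ENNReal.Tendsto.mul_const ENNReal.tendsto_ofReal_atTop (Or.inl ENNReal.top_ne_zero)
  rw [← negExp_top]
  refine ((continuous_negExp.tendsto _).comp h_mean).congr' ?_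
  filter_upwards [hS] with lam hlam
  exact (hlam.measure_forall_pathLoss_lt hM z).symm

lemma tendsto_measure_active_serving (hM : M.Valid) (hζ : M.IsPeakPathLoss ζ) (hq : q ≠ 0)
    (hrho : 0 < rho) (hS : ∀ᶠ lam in atTop, (S lam).Valid (μ lam) q rho lam) :
    Tendsto (fun lam => μ lam {ω | (S lam).active ((S lam).serving M ω) ω}) atTop (𝓝 0) := by
  have h_density : Tendsto (fun lam => ENNReal.ofReal (activeDensity q rho lam)) atTop
      (𝓝 (ENNReal.ofReal rho)) := ENNReal.tendsto_ofReal (tendsto_activeDensity hq rho)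
  have h_strong : Tendsto (fun t => 0 + ENNReal.ofReal rho *
      (volume.prod markLaw) (M.strongLinks (ζ / t))) (𝓝[>] 1) (𝓝 0) := by
    simpa only [zero_add, mul_zero] using ENNReal.Tendsto.const_mul
      (hM.tendsto_measure_strongLinks hζ) (Or.inr ENNReal.ofReal_ne_top)
  refine tendsto_zero_of_eventually_le
    (u := fun t lam => μ lam {ω | ∀ i, (S lam).pathLoss M i ω < ζ / t}
      + ENNReal.ofReal (activeDensity q rho lam) * (volume.prod markLaw) (M.strongLinks (ζ / t)))
    ?_ h_strong ?_ <;> filter_upwards [self_mem_nhdsWithin] with t ht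
  · exact (tendsto_measure_forall_pathLoss_lt hM hζ hS (div_lt_self hζ.pos ht)).add
      (ENNReal.Tendsto.mul_const h_density (Or.inl (ENNReal.ofReal_pos.2 hrho).ne'))
  · filter_upwards [hS] with lam hlam
    exact hlam.measure_active_serving_le hM (div_pos hζ.pos (one_pos.trans ht))

lemma tendsto_lintegral_negExp_totalPower (hM : M.Valid) (hq : q ≠ 0) (hrho : 0 < rho)
    (hS : ∀ᶠ lam in atTop, (S lam).Valid (μ lam) q rho lam) (hP : 0 < P) (hs : 0 < s) :
    Tendsto (fun lam => ∫⁻ ω, negExp (ENNReal.ofReal s * (S lam).totalPower M P ω) ∂μ lam) atTop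
      (𝓝 (negExp (ENNReal.ofReal rho * M.laplaceExponent P s))) := by
  have h_exponent := ENNReal.Tendsto.mul_const (b := M.laplaceExponent P s)
    (ENNReal.tendsto_ofReal (tendsto_activeDensity hq rho))
    (Or.inl (ENNReal.ofReal_pos.2 hrho).ne')
  refine ((continuous_negExp.tendsto _).comp h_exponent).congr' ?_
  filter_upwards [hS] with lam hlam
  exact (hlam.lintegral_negExp_totalPower hM hP hs).symm

lemma tendsto_lintegral_negExp_interference (hM : M.Valid) (hζ : M.IsPeakPathLoss ζ) (hq : q ≠ 0)
    (hrho : 0 < rho) (hS : ∀ᶠ lam in atTop, (S lam).Valid (μ lam) q rho lam) (hP : 0 < P)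
    (hs : 0 < s) :
    Tendsto (fun lam => ∫⁻ ω, negExp (ENNReal.ofReal s * (S lam).interference M P ω) ∂μ lam) atTop
      (𝓝 (negExp (ENNReal.ofReal rho * M.laplaceExponent P s))) := by
  have h_lower := tendsto_lintegral_negExp_totalPower hM hq hrho hS hP hs
  have h_upper := h_lower.add (tendsto_measure_active_serving hM hζ hq hrho hS)
  rw [add_zero] at h_upper
  refine tendsto_of_tendsto_of_tendsto_of_le_of_le' h_lower h_upper (.of_forall fun lam =>
    lintegral_mono fun ω =>
      antitone_negExp (mul_le_mul_right (interference_le_totalPower _ _ _ _) _)) ?_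
  filter_upwards [hS] with lam hlam
  exact hlam.lintegral_negExp_interference_le hM P s

lemma tendsto_laplace (hM : M.Valid) (hζ : M.IsPeakPathLoss ζ) (hq : q ≠ 0) (hrho : 0 < rho)
    (hS : ∀ᶠ lam in atTop, (S lam).Valid (μ lam) q rho lam) (hP : 0 < P) (hs : 0 < s) :
    Tendsto (fun lam => (S lam).laplace M (μ lam) P s) atTop (𝓝 (M.limitLaplace P rho s)) := by
  rw [M.limitLaplace_eq_toReal_negExp P s hrho.le]
  refine ((ENNReal.tendsto_toReal (negExp_ne_top _)).comp
    (tendsto_lintegral_negExp_interference hM hζ hq hrho hS hP hs)).congr' ?_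
  filter_upwards [hS] with lam hlam
  exact (hlam.laplace_eq_toReal_lintegral hM P s).symm

lemma tendsto_measureReal_lt_sinrWith (hM : M.Valid) (hζ : M.IsPeakPathLoss ζ) (hq : q ≠ 0)
    (hrho : 0 < rho) (hS : ∀ᶠ lam in atTop, (S lam).Valid (μ lam) q rho lam) (hP : 0 < P)
    {z : ℝ} (hz : 0 < z) (hg : 0 < g) {PN : ℝ} (hPN : 0 ≤ PN) :
    Tendsto (fun lam => (μ lam).real {ω | ENNReal.ofReal g < (S lam).sinrWith M P PN z ω}) atTop
      (𝓝 (Real.exp (-(PN * g / (P * z))) * M.limitLaplace P rho (g / (P * z)))) := by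
  have hs : 0 < g / (P * z) := div_pos hg (mul_pos hP hz)
  have h_noise : negExp (ENNReal.ofReal (g / (P * z)) * ENNReal.ofReal PN)
      = ENNReal.ofReal (Real.exp (-(PN * g / (P * z)))) := by
    rw [← ENNReal.ofReal_mul hs.le, negExp_ofReal (mul_nonneg hs.le hPN), mul_comm, mul_div_assoc]
  have h_laplace := (tendsto_laplace hM hζ hq hrho hS hP hs).const_mul
    (Real.exp (-(PN * g / (P * z))))
  refine h_laplace.congr' ?_
  filter_upwards [hS] with lam hlam
  rw [measureReal_def, hlam.measure_lt_sinrWith hM hP hz hg,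
    hlam.laplace_eq_toReal_lintegral hM]
  simp_rw [mul_add, negExp_add, h_noise]
  rw [lintegral_mul_const' _ _ ENNReal.ofReal_ne_top, ENNReal.toReal_mul,
    ENNReal.toReal_ofReal (Real.exp_pos _).le, mul_comm]

/-- Conditionally on the interference, raising the path loss of the serving link from `ζ / t` to
`ζ` raises the coverage probability by at most `t - 1`, and for large `λ` the actual path loss of
that link is at least `ζ / t` with high probability. -/
lemma tendsto_measure_lt_sinrWith_sub_measure_lt_sinr (hM : M.Valid) (hζ : M.IsPeakPathLoss ζ)
    (hS : ∀ᶠ lam in atTop, (S lam).Valid (μ lam) q rho lam) (hP : 0 < P) (hg : 0 < g) (PN : ℝ) :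
    Tendsto (fun lam => μ lam {ω | ENNReal.ofReal g < (S lam).sinrWith M P PN ζ ω}
      - μ lam {ω | ENNReal.ofReal g < (S lam).sinr M P PN ω}) atTop (𝓝 0) := by
  have h_excess : Tendsto (fun t => 0 + ENNReal.ofReal (t - 1)) (𝓝[>] 1) (𝓝 0) := by
    have h_continuous : Continuous fun t : ℝ => ENNReal.ofReal (t - 1) :=
      ENNReal.continuous_ofReal.comp (continuous_id.sub continuous_const)
    simpa using (h_continuous.tendsto 1).mono_left nhdsWithin_le_nhds
  refine tendsto_zero_of_eventually_le
    (u := fun t lam => μ lam {ω | ∀ i, (S lam).pathLoss M i ω < ζ / t} + ENNReal.ofReal (t - 1))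
    ?_ h_excess ?_ <;> filter_upwards [self_mem_nhdsWithin] with t ht
  · exact (tendsto_measure_forall_pathLoss_lt hM hζ hS (div_lt_self hζ.pos ht)).add_const _
  · filter_upwards [hS] with lam hlam
    have ht_pos : 0 < t := one_pos.trans ht
    have hz : 0 < ζ / t := div_pos hζ.pos ht_pos
    have h_mul := hlam.measure_lt_sinrWith_le_mul hM hP hg hz PN (le_of_lt ht)
    rw [mul_div_cancel₀ ζ ht_pos.ne'] at h_mul
    rw [tsub_le_iff_left, ← add_assoc]
    exact h_mul.trans (add_le_add_left (hlam.measure_lt_sinrWith_le hM hP.le hz PN g) _)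

lemma tendsto_pcov (hM : M.Valid) (hζ : M.IsPeakPathLoss ζ) (hq : q ≠ 0)
    (hrho : 0 < rho) (hS : ∀ᶠ lam in atTop, (S lam).Valid (μ lam) q rho lam) (hP : 0 < P)
    (hg : 0 < g) {PN : ℝ} (hPN : 0 ≤ PN) :
    Tendsto (fun lam => (S lam).pcov M (μ lam) P PN g) atTop
      (𝓝 (Real.exp (-(PN * g / (P * ζ))) * M.limitLaplace P rho (g / (P * ζ)))) := by
  have h_deficit := (ENNReal.tendsto_toReal ENNReal.zero_ne_top).comp
    (tendsto_measure_lt_sinrWith_sub_measure_lt_sinr hM hζ hS hP hg PN)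
  have h_limit :=
    (tendsto_measureReal_lt_sinrWith hM hζ hq hrho hS hP hζ.pos hg hPN).sub h_deficit
  rw [ENNReal.toReal_zero, sub_zero] at h_limit
  refine h_limit.congr' ?_
  filter_upwards [hS] with lam hlam
  have := hlam.isProbabilityMeasure
  have h_le := measure_lt_sinr_le (S lam) (μ lam) hM hP.le hζ.gain_le PN g
  rw [Function.comp_apply, ENNReal.toReal_sub_of_le h_le (measure_ne_top _ _)]
  exact sub_sub_cancel _ _

end Network

end DenseLimit

end UDN

end

theorem theorem1_general {k : ℕ} (M : UDN.PathLoss k) (hM : M.Valid) {ζ : ℝ}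
    (hζ : M.IsPeakPathLoss ζ) (P PN rho q g s : ℝ) (hP : 0 < P) (hPN : 0 ≤ PN) (hrho : 0 < rho)
    (hq : q ≠ 0) (hg : 0 < g) (hs : s = g / (P * ζ))
    (Ω : ℝ → Type*) [∀ lam, MeasurableSpace (Ω lam)] (μ : ∀ lam, Measure (Ω lam))
    (S : ∀ lam, UDN.Network (Ω lam)) (hS : ∀ᶠ lam in atTop, (S lam).Valid (μ lam) q rho lam) :
    Tendsto (fun lam => UDN.activeDensity q rho lam) atTop (𝓝 rho) ∧
    Tendsto (fun lam => (S lam).laplace M (μ lam) P s) atTop (𝓝 (M.limitLaplace P rho s)) ∧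
    Tendsto (fun lam => (μ lam).real {ω | ENNReal.ofReal g < (S lam).sinrWith M P PN ζ ω}) atTop
      (𝓝 (Real.exp (-(PN * g / (P * ζ))) * M.limitLaplace P rho s)) ∧
    Tendsto (fun lam => (S lam).pcov M (μ lam) P PN g) atTop
      (𝓝 (Real.exp (-(PN * g / (P * ζ))) * M.limitLaplace P rho s)) := by
  subst hs
  exact ⟨UDN.tendsto_activeDensity hq rho,
    UDN.Network.tendsto_laplace hM hζ hq hrho hS hP (div_pos hg (mul_pos hP hζ.pos)),
    UDN.Network.tendsto_measureReal_lt_sinrWith hM hζ hq hrho hS hP hζ.pos hg hPN,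
    UDN.Network.tendsto_pcov hM hζ hq hrho hS hP hg hPN⟩

theorem theorem1 {k : ℕ} (M : UDN.PathLoss k) (hM : M.Valid)
    -- a link at the beginning of the first piece can be LoS
    (hLoS : ∃ w, M.L < w ∧ M.piece w = 0 ∧ 0 < M.prL 0 w)
    -- no link is stronger than a first-piece LoS link at the smallest 3D distance `L`
    (hdomL : ∀ w, M.L ≤ w → M.zetaL w ≤ M.zetaPieceL 0 M.L)
    (hdomNL : ∀ w, M.L ≤ w → M.zetaNL w ≤ M.zetaPieceL 0 M.L)
    (P PN rho q g s : ℝ) (hP : 0 < P) (hPN : 0 ≤ PN) (hrho : 0 < rho) (hq : 0 < q) (hg : 0 < g)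
    (hs : s = g / (P * M.zetaPieceL 0 M.L))
    (Ω : ℝ → Type*) [∀ lam, MeasurableSpace (Ω lam)]
    (μ : ∀ lam, Measure (Ω lam)) [∀ lam, IsProbabilityMeasure (μ lam)]
    (S : ∀ lam, UDN.Network (Ω lam)) (hS : ∀ lam, 0 < lam → (S lam).Valid (μ lam) q rho lam) :
    Tendsto (fun lam => UDN.activeDensity q rho lam) atTop (𝓝 rho) ∧
    Tendsto (fun lam => (S lam).laplace M (μ lam) P s) atTop (𝓝 (M.limitLaplace P rho s)) ∧
    Tendsto (fun lam => (μ lam).real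
        {ω | ENNReal.ofReal g < (S lam).sinrWith M P PN (M.zetaPieceL 0 M.L) ω}) atTop
      (𝓝 (Real.exp (-(PN * g / (P * M.zetaPieceL 0 M.L))) * M.limitLaplace P rho s)) ∧
    Tendsto (fun lam => (S lam).pcov M (μ lam) P PN g) atTop
      (𝓝 (Real.exp (-(PN * g / (P * M.zetaPieceL 0 M.L))) * M.limitLaplace P rho s)) := by
  exact theorem1_general M hM (hM.isPeakPathLoss hLoS hdomL hdomNL) P PN rho q g s hP hPN hrho
    hq.ne' hg hs Ω μ S ((eventually_gt_atTop 0).mono hS)
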